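/- **Conventions.** $\lambda\in\mathbb N$ is the security parameter. Algorithms are non-uniform: an algorithm is a family, indexed by $\lambda$, of probabilistic Boolean circuits (with oracle gates where an oracle is given), and its running time is the circuit size. Let $\Gamma:\mathbb R\to\mathbb R$ with $\Gamma(\lambda)\ge\Omega(\lambda)$, and $\overline\tau:\mathbb R^2\to\mathbb R$. We write $f\le\mathrm{poly}(\Gamma)$ if $f(\lambda)=O(\Gamma(\lambda)^k)$ for some $k$, and $f\le\mathrm{negl}(\Gamma)$ if $\Gamma(\lambda)^k f(\lambda)\to0$ for all $k$. **MILR schemes.** An MILR scheme $\Pi=(\mathrm{Gen},\mathrm{Param},\mathrm{Enc},\mathrm{Dec})$ consists of $\mathrm{poly}(\lambda)$-time algorithms: $\mathrm{Gen}(1^\lambda)$ outputs a key in $\{0,1\}^\lambda$, $\mathrm{Param}(1^\lambda)$ outputs a public parameter of $\mathrm{poly}(\lambda)$ bits, $\mathrm{Enc}(x,p,m)$ outputs a ciphertext of $\mathrm{poly}(\lambda)$ bits for a bit $m$, and the deterministic $\mathrm{Dec}$ satisfies $\mathrm{Dec}(x,p,\mathrm{Enc}(x,p,m))=m$ with probability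 $1$. For keys $\vec x=(x_1,\dots,x_n)$, parameters $\vec p=(p_1,\dots,p_n)$ and $J\subseteq[n]$, the randomized oracle $\mathcal E_1(\vec x,\vec p,J)$ answers $(j,m)$ with $\mathrm{Enc}(x_j,p_j,m)$; the oracle $\mathcal E_0(\vec x,\vec p,J)$ answers with $\mathrm{Enc}(x_j,p_j,0)$ if $j\in J$, and with $\mathrm{Enc}(x_j,p_j,m)$ otherwise. The $x_i$ and $p_i$ are sampled independently from $\mathrm{Gen}(1^\lambda)$ and $\mathrm{Param}(1^\lambda)$. The scheme is $(\Gamma,\overline\tau)$-secure if 1. for every $n\le\mathrm{poly}(\Gamma)$ and every $\mathrm{poly}(\Gamma)$-time $\mathcal B$, $$\bigl|\Pr[\mathcal B^{\mathcal E_0(\vec x,\vec p,[n])}(\vec p)=1]-\Pr[\mathcal B^{\mathcal E_1(\vec x,\vec p,[n])}(\vec p)=1]\bigr|\le\mathrm{negl}(\Gamma);$$ 2. for every $n\le\mathrm{poly}(\Gamma)$, every $s\le n\lambda$ and every (possibly randomized, computationally unbounded) $F:(\{0,1\}^\lambda)^n\to\{0,1\}^s$ there is a randomized $J=J(\vec x,z,\vec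 p)\subseteq[n]$ with $|J|\ge n-\overline\tau(\lambda,s)$ always, such that for every $\mathrm{poly}(\Gamma)$-time $\mathcal B$, with $z\leftarrow F(\vec x)$ and $J\leftarrow J(\vec x,z,\vec p)$, $$\bigl|\Pr[\mathcal B^{\mathcal E_0(\vec x,\vec p,J)}(z,\vec p)=1]-\Pr[\mathcal B^{\mathcal E_1(\vec x,\vec p,J)}(z,\vec p)=1]\bigr|\le\mathrm{negl}(\Gamma).$$ **The $(\lambda,d)$-DA problem with sample complexity $n$ and space $s$.** An algorithm $\mathcal A=(\mathcal A_1,\mathcal A_2)$ shrinks a dataset $D=(x_1,\dots,x_n)\in(\{0,1\}^\lambda)^n$ to a summary $z\leftarrow\mathcal A_1(D)\in\{0,1\}^s$. Then it gets a query $q=((p_i,c_i))_{i\in[n]}$, where $p_i$ is a public parameter and $c_i=(c_{i,1},\dots,c_{i,d})$ with ciphertexts $c_{i,j}$, and it answers $\vec a\leftarrow\mathcal A_2(z,q)\in[0,1]^d$, with coordinates in fixed-point representation. It *solves* the problem if for all $D$ and all $q$ such that each $p_i$ is a possible output of $\mathrm{Param}(1^\lambda)$ and each $c_i$ is a bitwise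 encryption of some vector in $\{0,1\}^d$ under $x_i,p_i$, with probability at least $9/10$, $$\Bigl\|\vec a-\tfrac1n\sum_{i=1}^n\mathrm{Dec}(x_i,p_i,c_i)\Bigr\|_\infty\le\tfrac1{10}\qquad(\mathrm{Dec}\text{ is applied to each coordinate of }c_i).$$ It is $(\varepsilon,\delta)$-*CDP* if for all $\mathrm{poly}(\Gamma)$-time $(Q,T)$, where $Q$ outputs a string $r$, a query $q$ and two datasets $D_0,D_1$ of size $n$ that differ in at most one entry, $$\Pr[T(r,\mathcal A_2(\mathcal A_1(D_0),q))=1]\le e^{\varepsilon}\Pr[T(r,\mathcal A_2(\mathcal A_1(D_1),q))=1]+\delta(n)+\mathrm{negl}(\Gamma).$$ **Theorem.** For every constant $\varepsilon\in\mathbb R$ there is a constant $c>0$ such that the following holds. Let $\Pi$ be a $(\Gamma,\overline\tau)$-secure MILR scheme, where $\Gamma(\lambda)\ge\Omega(\lambda)$. Let $n,d,s$ be functions of $\lambda$ with $n\ge2$ and $n,d\le\mathrm{poly}(\Gamma)$, and let $\delta(n)\le\frac1{4n(e^\varepsilon+1)}$. For every $\mathrm{poly}(\Gamma)$-time $(\varepsilon,\delta)$-CDP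 algorithm that solves the $(\lambda,d)$-DA problem with sample complexity $n$ and space $s$, for all sufficiently large $\lambda$, $$\overline\tau(\lambda,s)\ \ge\ c\,\sqrt{\frac{d}{\log n}},\qquad\text{that is,}\qquad\overline\tau(\lambda,s)=\Omega\Bigl(\sqrt{d/\log n}\Bigr).$$ -/

import Mathlib

open Filter Asymptotics

noncomputable section

/-- Bit strings of length `k`. -/
abbrev Bits (k : ℕ) : Type := Fin k → Bool

/-- The probability of an event under a discrete distribution, as a real number. -/
def prob {α : Type} (μ : PMF α) (E : Set α) : ℝ := (μ.toOuterMeasure E).toReal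

/-- The joint distribution of `n` independent samples of `μ`. -/
def iid {α : Type} [Fintype α] (n : ℕ) (μ : PMF α) : PMF (Fin n → α) :=
  PMF.ofFintype (fun x => ∏ i, μ (x i)) (by
    classical
    have h := Finset.prod_univ_sum (fun _ : Fin n => (Finset.univ : Finset α))
      (fun (_ : Fin n) a => μ a)
    rw [Fintype.piFinset_univ] at h
    rw [← h]
    have h1 : ∑ a, μ a = 1 := (tsum_fintype (fun a => μ a)).symm.trans μ.tsum_coe
    simp [h1])

/-! ### Growth -/

/-- `f ≤ poly(g)`, as functions of the security parameter. -/
def PolyBounded (g : ℕ → ℝ) (f : ℕ → ℕ) : Prop :=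
  ∃ k : ℕ, (fun l => (f l : ℝ)) =O[atTop] fun l => g l ^ k

/-! ### Non-uniform probabilistic (oracle) algorithms -/

/-- Probabilistic Boolean circuits with oracle gates, as straight-line programs. `ι` is the set of
wires that are available (for a whole circuit: its input wires) and `κ` is the set of output wires.
Every gate adds its result to the available wires:
* `const b`: a constant bit;
* `gate f a b`: an arbitrary binary Boolean gate;
* `coin`: a fresh uniformly random bit;
* `query j m`: a call of the oracle on the index `j` and the bit on wire `m`. Its answer is a bit
  string indexed by `β`, and randomized oracles use fresh randomness in every call. (A call whose
  index is itself computed amounts to calling all indices and selecting one of the answers, which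
  costs a factor `|J|` only.)
* `out o`: stop and output the wires `o`. -/
inductive Circuit (J β κ : Type) : Type → Type 1
  | out {ι : Type} (o : κ → ι) : Circuit J β κ ι
  | const {ι : Type} (b : Bool) (next : Circuit J β κ (Option ι)) : Circuit J β κ ι
  | gate {ι : Type} (f : Bool → Bool → Bool) (a b : ι) (next : Circuit J β κ (Option ι)) :
      Circuit J β κ ι
  | coin {ι : Type} (next : Circuit J β κ (Option ι)) : Circuit J β κ ι
  | query {ι : Type} (j : J) (m : ι) (next : Circuit J β κ (ι ⊕ β)) : Circuit J β κ ι

namespace Circuit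

variable {J β κ : Type}

/-- The number of gates, where an oracle call is charged for the length of its answer, and where
the outputs are charged for their length. -/
def size [Fintype β] [Fintype κ] : {ι : Type} → Circuit J β κ ι → ℕ
  | _, out _ => Fintype.card κ
  | _, const _ c => c.size + 1
  | _, gate _ _ _ c => c.size + 1
  | _, coin c => c.size + 1
  | _, query _ _ c => c.size + 1 + Fintype.card β

/-- The distribution of the output of a circuit with oracle `O`, given the values of the available
wires. -/
def run (O : J → Bool → PMF (β → Bool)) :
    {ι : Type} → Circuit J β κ ι → (ι → Bool) → PMF (κ → Bool)
  | _, out o, v => PMF.pure (fun k => v (o k))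
  | _, const b c, v => c.run O (fun w => w.elim b v)
  | _, gate f a b c, v => c.run O (fun w => w.elim (f (v a) (v b)) v)
  | _, coin c, v => (PMF.uniformOfFintype Bool).bind fun r => c.run O (fun w => w.elim r v)
  | _, query j m c, v => (O j (v m)).bind fun y => c.run O (Sum.elim v y)

end Circuit

/-- Circuits without oracle, with inputs indexed by `ι` and outputs indexed by `κ`. -/
abbrev PlainCircuit (ι κ : Type) : Type 1 := Circuit Empty Empty κ ι

/-- The distribution of the output of a circuit without oracle. -/
def PlainCircuit.eval {ι κ : Type} (c : PlainCircuit ι κ) (v : ι → Bool) : PMF (κ → Bool) :=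
  Circuit.run (fun j _ => j.elim) c v

/-- A family of randomized maps (one for each value of the security parameter) is computed by a
family of plain circuits of size `poly(g)`. -/
def Efficient (g : ℕ → ℝ) {ι κ : ℕ → Type} [∀ l, Fintype (κ l)]
    (f : ∀ l, (ι l → Bool) → PMF (κ l → Bool)) : Prop :=
  ∃ c : ∀ l, PlainCircuit (ι l) (κ l),
    PolyBounded g (fun l => (c l).size) ∧ ∀ l v, (c l).eval v = f l v

/-! ### Multi-instance leakage-resilient schemes -/

/-- The syntax of an MILR scheme. The security parameter is `l`; keys have `l` bits, and `Enc`
encrypts single bits. -/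
structure MILRScheme where
  /-- length of the public parameters -/
  paramLen : ℕ → ℕ
  /-- length of the ciphertexts -/
  cipherLen : ℕ → ℕ
  Gen : ∀ l, PMF (Bits l)
  Param : ∀ l, PMF (Bits (paramLen l))
  Enc : ∀ l, Bits l → Bits (paramLen l) → Bool → PMF (Bits (cipherLen l))
  Dec : ∀ l, Bits l → Bits (paramLen l) → Bits (cipherLen l) → Bool
  paramLen_poly : PolyBounded (fun l => (l : ℝ)) paramLen
  cipherLen_poly : PolyBounded (fun l => (l : ℝ)) cipherLen
  gen_efficient : Efficient (fun l => (l : ℝ)) (ι := fun _ => Empty) (κ := fun l => Fin l)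
    fun l _ => Gen l
  param_efficient : Efficient (fun l => (l : ℝ)) (ι := fun _ => Empty)
    (κ := fun l => Fin (paramLen l)) fun l _ => Param l
  enc_efficient : Efficient (fun l => (l : ℝ)) (ι := fun l => Fin l ⊕ Fin (paramLen l) ⊕ Unit)
    (κ := fun l => Fin (cipherLen l))
    fun l v => Enc l (fun i => v (.inl i)) (fun i => v (.inr (.inl i))) (v (.inr (.inr ())))
  dec_efficient : Efficient (fun l => (l : ℝ))
    (ι := fun l => Fin l ⊕ Fin (paramLen l) ⊕ Fin (cipherLen l)) (κ := fun _ => Unit)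
    fun l v => PMF.pure fun _ =>
      Dec l (fun i => v (.inl i)) (fun i => v (.inr (.inl i))) (fun i => v (.inr (.inr i)))
  /-- decryption is correct with probability one -/
  dec_enc : ∀ l, ∀ x ∈ (Gen l).support, ∀ p ∈ (Param l).support, ∀ m,
    ∀ c ∈ (Enc l x p m).support, Dec l x p c = m

namespace MILRScheme

variable (P : MILRScheme)

/-- The encryption oracle `ℰ₁`: on `(j, m)` it returns `Enc(xⱼ, pⱼ, m)`. -/
def oracle₁ {l n : ℕ} (x : Fin n → Bits l) (p : Fin n → Bits (P.paramLen l))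
    (_S : Finset (Fin n)) (j : Fin n) (m : Bool) : PMF (Bits (P.cipherLen l)) :=
  P.Enc l (x j) (p j) m

/-- The encryption oracle `ℰ₀`: on `(j, m)` it returns `Enc(xⱼ, pⱼ, 0)` if `j` is one of the hidden
coordinates `S`, and `Enc(xⱼ, pⱼ, m)` otherwise. -/
def oracle₀ {l n : ℕ} (x : Fin n → Bits l) (p : Fin n → Bits (P.paramLen l))
    (S : Finset (Fin n)) (j : Fin n) (m : Bool) : PMF (Bits (P.cipherLen l)) :=
  if j ∈ S then P.Enc l (x j) (p j) false else P.Enc l (x j) (p j) m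

/-- The encryption oracle `ℰ_b`. -/
def oracle (b : Bool) {l n : ℕ} (x : Fin n → Bits l) (p : Fin n → Bits (P.paramLen l))
    (S : Finset (Fin n)) : Fin n → Bool → PMF (Bits (P.cipherLen l)) :=
  if b then P.oracle₁ x p S else P.oracle₀ x p S

/-- The probability that `B` outputs `1` when it gets the public parameters and the oracle `ℰ_b`
with all coordinates hidden. -/
def semanticGame {l n : ℕ} (b : Bool)
    (B : Circuit (Fin n) (Fin (P.cipherLen l)) Unit (Fin n × Fin (P.paramLen l))) : ℝ :=
  prob
    ((iid n (P.Gen l)).bind fun x =>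
      (iid n (P.Param l)).bind fun p =>
      B.run (P.oracle b x p Finset.univ) fun i => p i.1 i.2)
    {a | a () = true}

/-- The probability that `B` outputs `1` when it gets the leakage `z ← F(x)`, the public parameters
and the oracle `ℰ_b` with the coordinates `J(x, z, p)` hidden. -/
def leakageGame {l n s : ℕ} (b : Bool) (F : (Fin n → Bits l) → PMF (Bits s))
    (J : (Fin n → Bits l) → Bits s → (Fin n → Bits (P.paramLen l)) → PMF (Finset (Fin n)))
    (B : Circuit (Fin n) (Fin (P.cipherLen l)) Unit (Fin s ⊕ Fin n × Fin (P.paramLen l))) : ℝ :=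
  prob
    ((iid n (P.Gen l)).bind fun x =>
      (F x).bind fun z =>
      (iid n (P.Param l)).bind fun p =>
      (J x z p).bind fun S =>
      B.run (P.oracle b x p S) (Sum.elim z fun i => p i.1 i.2))
    {a | a () = true}

/-- Multi semantic security, against non-uniform `poly(Γ)`-time adversaries. -/
def MultiSemanticSecure (Γ : ℝ → ℝ) : Prop :=
  ∀ n : ℕ → ℕ, PolyBounded (fun l => Γ l) n →
  ∀ B : ∀ l, Circuit (Fin (n l)) (Fin (P.cipherLen l)) Unit (Fin (n l) × Fin (P.paramLen l)),
    PolyBounded (fun l => Γ l) (fun l => (B l).size) →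
    SuperpolynomialDecay atTop (fun l : ℕ => Γ l)
      (fun l => |P.semanticGame false (B l) - P.semanticGame true (B l)|)

/-- Multi-security against a bounded preprocessing adversary: an arbitrary randomized
preprocessing procedure `F` with `s` bits of output, followed by a non-uniform `poly(Γ)`-time
adversary `B`. -/
def MultiLeakageSecure (Γ : ℝ → ℝ) (τ : ℝ → ℝ → ℝ) : Prop :=
  ∀ n : ℕ → ℕ, PolyBounded (fun l => Γ l) n →
  ∀ s : ℕ → ℕ, (∀ l, s l ≤ n l * l) →
  ∀ F : ∀ l, (Fin (n l) → Bits l) → PMF (Bits (s l)),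
  ∃ J : ∀ l, (Fin (n l) → Bits l) → Bits (s l) → (Fin (n l) → Bits (P.paramLen l)) →
      PMF (Finset (Fin (n l))),
    (∀ l x z p, ∀ S ∈ (J l x z p).support, (n l : ℝ) - τ l (s l) ≤ S.card) ∧
    ∀ B : ∀ l, Circuit (Fin (n l)) (Fin (P.cipherLen l)) Unit
        (Fin (s l) ⊕ Fin (n l) × Fin (P.paramLen l)),
      PolyBounded (fun l => Γ l) (fun l => (B l).size) →
      SuperpolynomialDecay atTop (fun l : ℕ => Γ l)
        (fun l => |P.leakageGame false (F l) (J l) (B l) - P.leakageGame true (F l) (J l) (B l)|)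

/-- `(Γ, τ)`-security against space bounded preprocessing adversaries. -/
def Secure (Γ : ℝ → ℝ) (τ : ℝ → ℝ → ℝ) : Prop :=
  P.MultiSemanticSecure Γ ∧ P.MultiLeakageSecure Γ τ

end MILRScheme

/-! ### The decoded average problem -/

/-- A query of the decoded average problem: `n` public parameters and `n` vectors of `d`
ciphertexts (a vector of `d` bits is encrypted bit by bit). -/
structure DAQuery (P : MILRScheme) (l n d : ℕ) where
  param : Fin n → Bits (P.paramLen l)
  cipher : Fin n → Fin d → Bits (P.cipherLen l)

/-- Positions in the bit representation of a query. -/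
abbrev DAQueryIdx (P : MILRScheme) (l n d : ℕ) : Type :=
  (Fin n × Fin (P.paramLen l)) ⊕ (Fin n × Fin d × Fin (P.cipherLen l))

namespace DAQuery

variable {P : MILRScheme} {l n d : ℕ}

/-- The bit representation of a query. -/
def toBits (q : DAQuery P l n d) : DAQueryIdx P l n d → Bool :=
  Sum.elim (fun i => q.param i.1 i.2) (fun i => q.cipher i.1 i.2.1 i.2.2)

/-- The query with a given bit representation. -/
def ofBits (v : DAQueryIdx P l n d → Bool) : DAQuery P l n d where
  param i k := v (.inl (i, k))
  cipher i j k := v (.inr (i, j, k))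

/-- `q` consists of public parameters and of encryptions of binary vectors under the keys `D`. -/
def IsValid (q : DAQuery P l n d) (D : Fin n → Bits l) : Prop :=
  (∀ i, q.param i ∈ (P.Param l).support) ∧
  ∃ y : Fin n → Fin d → Bool, ∀ i j, q.cipher i j ∈ (P.Enc l (D i) (q.param i) (y i j)).support

/-- The decrypted average vector. -/
def dav (q : DAQuery P l n d) (D : Fin n → Bits l) (j : Fin d) : ℝ :=
  (∑ i, if P.Dec l (D i) (q.param i) (q.cipher i j) then (1 : ℝ) else 0) / n

end DAQuery

/-- The number in `[0, 1]` with the fixed-point representation `v`: one integer bit and `b`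
fractional bits, cut off at `1`. -/
def fixedPoint {b : ℕ} (v : Fin (b + 1) → Bool) : ℝ :=
  min 1 ((∑ k, if v k then (2 : ℝ) ^ (k : ℕ) else 0) / 2 ^ b)

/-- A (non-uniform) algorithm for the decoded average problem with sample complexity `n`, dimension
`d` and space `s`: `A₁` shrinks a dataset of `n` keys to a summary of `s` bits, and `A₂` gets the
summary and a query, and outputs `d` numbers in fixed-point representation. -/
structure DAAlgorithm (P : MILRScheme) (n d s : ℕ → ℕ) where
  /-- number of fractional bits of the answers -/
  prec : ℕ → ℕ
  A₁ : ∀ l, PlainCircuit (Fin (n l) × Fin l) (Fin (s l))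
  A₂ : ∀ l, PlainCircuit (Fin (s l) ⊕ DAQueryIdx P l (n l) (d l)) (Fin (d l) × Fin (prec l + 1))

namespace DAAlgorithm

variable {P : MILRScheme} {n d s : ℕ → ℕ} (A : DAAlgorithm P n d s)

/-- The answer of the algorithm on a dataset and a query, as a bit string. -/
def answer (l : ℕ) (D : Fin (n l) → Bits l) (q : DAQuery P l (n l) (d l)) :
    PMF (Fin (d l) × Fin (A.prec l + 1) → Bool) :=
  ((A.A₁ l).eval fun i => D i.1 i.2).bind fun z => (A.A₂ l).eval (Sum.elim z q.toBits)

/-- The running time is `poly(g)`. -/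
def PolyTime (g : ℕ → ℝ) : Prop :=
  PolyBounded g (fun l => (A.A₁ l).size) ∧ PolyBounded g (fun l => (A.A₂ l).size)

/-- The algorithm solves the decoded average problem: for every dataset and every query, with
probability at least `9/10` the answer is within `1/10` of the decrypted average vector in the
maximum norm. -/
def Solves : Prop :=
  ∀ (l : ℕ) (D : Fin (n l) → Bits l) (q : DAQuery P l (n l) (d l)), q.IsValid D →
    9 / 10 ≤ prob (A.answer l D q)
      {a | ∀ j, |fixedPoint (fun k => a (j, k)) - q.dav D j| ≤ 1 / 10}

end DAAlgorithm

/-- Two datasets are neighboring if they differ in at most one entry. -/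
def Neighboring {α : Type} {n : ℕ} (D₀ D₁ : Fin n → α) : Prop :=
  ∃ i, ∀ j, j ≠ i → D₀ j = D₁ j

/-- Positions in the output of the first part of a privacy adversary: a state `r` of `R` bits, a
query, and two datasets of `n` keys. -/
abbrev CDPChoiceIdx (P : MILRScheme) (l n d R : ℕ) : Type :=
  Fin R ⊕ DAQueryIdx P l n d ⊕ (Fin n × Fin l) ⊕ (Fin n × Fin l)

namespace CDPChoice

variable {P : MILRScheme} {l n d R : ℕ} (o : CDPChoiceIdx P l n d R → Bool)

/-- The state. -/
def state : Bits R := fun i => o (.inl i)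

/-- The query. -/
def query : DAQuery P l n d := DAQuery.ofBits fun i => o (.inr (.inl i))

/-- The first dataset for `b = false`, and the second one for `b = true`. -/
def data (b : Bool) : Fin n → Bits l := fun i k =>
  if b then o (.inr (.inr (.inr (i, k)))) else o (.inr (.inr (.inl (i, k))))

end CDPChoice

namespace DAAlgorithm

variable {P : MILRScheme} {n d s : ℕ → ℕ} (A : DAAlgorithm P n d s)

/-- The probability that `T(r, a) = 1`, where `(r, q, D₀, D₁) ← Q`, and where `a` is the answer of
the algorithm on the dataset `D_b` and the query `q`. -/
def cdpGame {l R : ℕ} (b : Bool) (Q : PlainCircuit Empty (CDPChoiceIdx P l (n l) (d l) R))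
    (T : PlainCircuit (Fin R ⊕ Fin (d l) × Fin (A.prec l + 1)) Unit) : ℝ :=
  prob
    ((Q.eval Empty.elim).bind fun o =>
      (A.answer l (CDPChoice.data o b) (CDPChoice.query o)).bind fun a =>
      T.eval (Sum.elim (CDPChoice.state o) a))
    {t | t () = true}

/-- `(ε, δ)`-computational differential privacy of the answers, at security level `Γ`, i.e. against
non-uniform `poly(Γ)`-time adversaries `(Q, T)` and up to `negl(Γ)`. The query is chosen by the
adversary. -/
def IsCDP (Γ : ℝ → ℝ) (ε : ℝ) (δ : ℕ → ℝ) : Prop :=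
  ∀ (R : ℕ → ℕ) (Q : ∀ l, PlainCircuit Empty (CDPChoiceIdx P l (n l) (d l) (R l)))
    (T : ∀ l, PlainCircuit (Fin (R l) ⊕ Fin (d l) × Fin (A.prec l + 1)) Unit),
    PolyBounded (fun l => Γ l) (fun l => (Q l).size) →
    PolyBounded (fun l => Γ l) (fun l => (T l).size) →
    (∀ l, ∀ o ∈ ((Q l).eval Empty.elim).support,
      Neighboring (CDPChoice.data o false) (CDPChoice.data o true)) →
    ∃ ν : ℕ → ℝ, SuperpolynomialDecay atTop (fun l : ℕ => Γ l) ν ∧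
      ∀ l, A.cdpGame false (Q l) (T l) ≤
        Real.exp ε * A.cdpGame true (Q l) (T l) + δ (n l) + ν l

end DAAlgorithm

end

/-! The proof turns a fingerprinting code into an attack on privacy. Row i of a random code with d
columns is the message encrypted for user i, and the answers are rounded to bits b. Suppose that τ
is too small.

Accuracy forces an accusation. The summary computed by `A₁` is leakage about the keys, so leakage
security permits replacing the ciphertexts of all but at most τ users by encryptions of zero, at a
negligible cost for every efficiently testable event (`abs_prob_leakDist_sub_le`). Then b depends
only on the codewords of a set C of at most τ exposed users, although it must follow the column
averages over all n users. A column is biased, with mean 19/20 or 1/20, or it has a random mean p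
with density proportional to 1/(p(1-p)). In a column of the second kind user i scores b_j(x_i -
y_i), where y_i is a reference bit with the same mean. The derivative in p of the Bernoulli weight
of x is the weight times ∑(x_i - p)/(p(1-p)). Integrating it shows that the total score has the same
mean as the correlation of b with the signs of the biased columns (`sum_columnWeight_allScores`),
and users outside C contribute zero on average. For accurate answers this correlation is of order d.
A second moment bound then makes the scores in C add up to order d with high probability, so some
user scores above T if τT is a small multiple of d (`codeMean_prob_no_accusation_le`).

Privacy and encryption forbid accusations. Removing the key of user i from the dataset changes the
probability of accusing i by a factor e^ε and an additive δ (`prob_answerDist_le_of_cdp`). The key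
is then used only for encryption, so semantic security erases the messages of i
(`prob_answerDist_withoutUser_le`). Now b is independent of codeword i, and exchanging x_i and y_i
flips the sign of each column's score, so the score exceeds T with probability at most exp(-T²/(2d))
(`codeMean_prob_score_le`). With T of order √(d log n) the sum over all users stays below a
constant, a contradiction in `le_of_few_exposed_users`. The case τ < 1 is separate and elementary
(`le_of_no_exposed_user`).

The code is hard-wired into the adversaries, which only evaluate threshold tests on the rounded
answers. Since they vary with the code and the user, the negligible errors are first made uniform
over all small circuits (`exists_uniform_negligible`). -/

noncomputable section

/-! ### Discrete probability -/

/-- Resampling one coordinate of a product weight. -/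
theorem sum_prod_resample {R ι α : Type*} [CommSemiring R] [Fintype ι] [DecidableEq ι] [Fintype α]
    (w w₀ : ι → α → R) (j : ι) (h : ∀ k, k ≠ j → w k = w₀ k) (h₀ : ∑ a, w₀ j a = 1)
    (F : (ι → α) → R) :
    ∑ f, (∏ k, w k (f k)) * F f =
      ∑ f, (∏ k, w₀ k (f k)) * ∑ a, w j a * F (Function.update f j a) := by
  have e1 : ∑ f, (∏ k, w k (f k)) * F f =
      ∑ q : (ι → α) × α, (∏ k, w k (q.1 k)) * F q.1 * w₀ j q.2 := by
    rw [Fintype.sum_prod_type]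
    refine Finset.sum_congr rfl fun f _ => ?_
    simp only [← Finset.mul_sum, h₀, mul_one]
  have e2 : ∑ f, (∏ k, w₀ k (f k)) * ∑ a, w j a * F (Function.update f j a) =
      ∑ q : (ι → α) × α, (∏ k, w₀ k (q.1 k)) * (w j q.2 * F (Function.update q.1 j q.2)) := by
    rw [Fintype.sum_prod_type]
    exact Finset.sum_congr rfl fun f _ => by rw [Finset.mul_sum]
  rw [e1, e2]
  -- Exchanging coordinate `j` with the extra independent sample `a` matches the two sums term by
  -- term.
  have hinv : Function.Involutive
      (fun q : (ι → α) × α => (Function.update q.1 j q.2, q.1 j)) := by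
    intro q; ext <;> simp
  refine Fintype.sum_equiv hinv.toPerm _ _ fun q => ?_
  obtain ⟨f, a⟩ := q
  simp only [Function.Involutive.coe_toPerm, Function.update_idem, Function.update_eq_self]
  rw [← Finset.mul_prod_erase _ _ (Finset.mem_univ j),
    ← Finset.mul_prod_erase (Finset.univ) (fun k => w₀ k (Function.update f j a k))
      (Finset.mem_univ j)]
  have e3 : ∏ k ∈ Finset.univ.erase j, w₀ k (Function.update f j a k) =
      ∏ k ∈ Finset.univ.erase j, w k (f k) := by
    refine Finset.prod_congr rfl fun k hk => ?_
    have hk' := Finset.ne_of_mem_erase hk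
    rw [Function.update_of_ne hk', h k hk']
  rw [e3, Function.update_self]
  ring

theorem prob_eq_sum {α : Type} [Fintype α] (μ : PMF α) (E : Set α) [DecidablePred (· ∈ E)] :
    prob μ E = ∑ a, (μ a).toReal * (if a ∈ E then 1 else 0) := by
  rw [prob, PMF.toOuterMeasure_apply_fintype, ENNReal.toReal_sum]
  · refine Finset.sum_congr rfl fun a _ => ?_
    by_cases h : a ∈ E <;> simp [h]
  · intro a _
    by_cases h : a ∈ E <;> simp [h, PMF.apply_ne_top]

theorem prob_ne_top {α : Type} (μ : PMF α) (E : Set α) : μ.toOuterMeasure E ≠ ⊤ :=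
  ne_top_of_le_ne_top ENNReal.one_ne_top <| by
    rw [PMF.toOuterMeasure_apply]
    calc ∑' x, E.indicator μ x ≤ ∑' x, μ x :=
          ENNReal.tsum_le_tsum fun x => Set.indicator_le_self _ _ _
      _ = 1 := μ.tsum_coe

theorem prob_nonneg {α : Type} (μ : PMF α) (E : Set α) : 0 ≤ prob μ E := ENNReal.toReal_nonneg

theorem prob_mono {α : Type} (μ : PMF α) {E E' : Set α} (h : E ⊆ E') : prob μ E ≤ prob μ E' :=
  ENNReal.toReal_mono (prob_ne_top μ E') (μ.toOuterMeasure.mono h)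

theorem prob_le_one {α : Type} (μ : PMF α) (E : Set α) : prob μ E ≤ 1 := by
  have h : μ.toOuterMeasure E ≤ 1 := by
    rw [PMF.toOuterMeasure_apply]
    calc ∑' x, E.indicator μ x ≤ ∑' x, μ x :=
          ENNReal.tsum_le_tsum fun x => Set.indicator_le_self _ _ _
      _ = 1 := μ.tsum_coe
  simpa [prob] using ENNReal.toReal_mono ENNReal.one_ne_top h

theorem prob_map {α β : Type} (μ : PMF α) (f : α → β) (E : Set β) :
    prob (μ.map f) E = prob μ (f ⁻¹' E) := by
  rw [prob, PMF.toOuterMeasure_map_apply, prob]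

theorem sum_toReal {α : Type} [Fintype α] (μ : PMF α) : ∑ a, (μ a).toReal = 1 := by
  rw [← ENNReal.toReal_sum fun a _ => PMF.apply_ne_top μ a, ← tsum_fintype (L := .unconditional _),
    μ.tsum_coe, ENNReal.toReal_one]

theorem prob_bind {α β : Type} [Fintype α] (μ : PMF α) (f : α → PMF β) (E : Set β) :
    prob (μ.bind f) E = ∑ a, (μ a).toReal * prob (f a) E := by
  rw [prob, PMF.toOuterMeasure_bind_apply, tsum_fintype, ENNReal.toReal_sum]
  · simp [prob]
  · exact fun a _ => ENNReal.mul_ne_top (PMF.apply_ne_top μ a) (prob_ne_top _ _)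

/-- Affine bounds survive averaging because the weights sum to one. The hybrid arguments peel off
common randomness with this lemma and compare what remains pointwise. -/
theorem prob_bind_le {α β γ : Type} [Fintype α] (μ : PMF α) (f : α → PMF β) (g : α → PMF γ)
    (E : Set β) (E' : Set γ) {a b : ℝ}
    (h : ∀ x ∈ μ.support, prob (f x) E ≤ a * prob (g x) E' + b) :
    prob (μ.bind f) E ≤ a * prob (μ.bind g) E' + b := by
  rw [prob_bind, prob_bind, Finset.mul_sum]
  calc ∑ x, (μ x).toReal * prob (f x) E
      ≤ ∑ x, (μ x).toReal * (a * prob (g x) E' + b) := by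
        refine Finset.sum_le_sum fun x _ => ?_
        by_cases hx : x ∈ μ.support
        · exact mul_le_mul_of_nonneg_left (h x hx) ENNReal.toReal_nonneg
        · simp [(PMF.apply_eq_zero_iff μ x).2 hx]
    _ = ∑ x, a * ((μ x).toReal * prob (g x) E') + (∑ x, (μ x).toReal) * b := by
        rw [Finset.sum_mul, ← Finset.sum_add_distrib]
        exact Finset.sum_congr rfl fun x _ => by ring
    _ = _ := by rw [sum_toReal, one_mul]

theorem le_prob_bind {α β : Type} [Fintype α] (μ : PMF α) (f : α → PMF β) (E : Set β) {b : ℝ}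
    (h : ∀ x ∈ μ.support, b ≤ prob (f x) E) : b ≤ prob (μ.bind f) E := by
  rw [prob_bind]
  calc b = ∑ x, (μ x).toReal * b := by rw [← Finset.sum_mul, sum_toReal, one_mul]
    _ ≤ _ := by
        refine Finset.sum_le_sum fun x _ => ?_
        by_cases hx : x ∈ μ.support
        · exact mul_le_mul_of_nonneg_left (h x hx) ENNReal.toReal_nonneg
        · simp [(PMF.apply_eq_zero_iff μ x).2 hx]

/-- The joint distribution of independent samples. -/
def indep {ι α : Type} [Fintype ι] [DecidableEq ι] [Fintype α] (D : ι → PMF α) : PMF (ι → α) :=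
  PMF.ofFintype (fun x => ∏ i, D i (x i)) (by
    classical
    have h := Finset.prod_univ_sum (fun _ : ι => (Finset.univ : Finset α)) (fun i a => D i a)
    rw [Fintype.piFinset_univ] at h
    rw [← h]
    have h1 : ∀ i, ∑ a, D i a = 1 := fun i =>
      (tsum_fintype (fun a => D i a)).symm.trans (D i).tsum_coe
    simp [h1])

section indep
variable {ι α : Type} [Fintype ι] [DecidableEq ι] [Fintype α]

theorem indep_apply (D : ι → PMF α) (x : ι → α) : indep D x = ∏ i, D i (x i) :=
  PMF.ofFintype_apply _ _

theorem mem_support_indep {D : ι → PMF α} {x : ι → α} (h : x ∈ (indep D).support) (i : ι) :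
    x i ∈ (D i).support := by
  rw [PMF.mem_support_iff, indep_apply] at h
  rw [PMF.mem_support_iff]
  exact fun h0 => h (Finset.prod_eq_zero (Finset.mem_univ i) h0)

/-- The value of `D₀` at `i` is overwritten, so it may be chosen freely. This isolates the key, the
parameter and the ciphertexts of a single user. -/
theorem indep_eq_bind_update (D D₀ : ι → PMF α) (i : ι) (h : ∀ k, k ≠ i → D k = D₀ k) :
    indep D = (indep D₀).bind fun c => (D i).map (Function.update c i) := by
  classical
  ext f
  have := sum_prod_resample (R := ENNReal) (fun k a => D k a) (fun k a => D₀ k a) i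
    (fun k hk => by rw [h k hk])
    ((tsum_fintype (fun a => D₀ i a)).symm.trans (D₀ i).tsum_coe) (fun g => if f = g then 1 else 0)
  simp only [mul_ite, mul_one, mul_zero, Finset.sum_ite_eq, Finset.mem_univ, if_true] at this
  rw [indep_apply, this, PMF.bind_apply, tsum_fintype]
  refine Finset.sum_congr rfl fun c _ => ?_
  rw [indep_apply, PMF.map_apply, tsum_fintype]
  congr!

theorem indep_map {β : Type} [Fintype β] (D : ι → PMF α) (e : α → β) :
    indep (fun i => (D i).map e) = (indep D).map fun c i => e (c i) := by
  classical
  ext f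
  rw [indep_apply, PMF.map_apply, tsum_fintype]
  simp only [PMF.map_apply, tsum_fintype, indep_apply]
  rw [Finset.prod_univ_sum, Fintype.piFinset_univ]
  refine Finset.sum_congr rfl fun c _ => ?_
  by_cases h : f = fun i => e (c i)
  · rw [if_pos h]
    exact Finset.prod_congr rfl fun i _ => if_pos (congrFun h i)
  · rw [if_neg h]
    obtain ⟨i, hi⟩ := Function.ne_iff.1 h
    exact Finset.prod_eq_zero (Finset.mem_univ i) (if_neg hi)

end indep

theorem indep_fin_succ {α : Type} [Fintype α] {k : ℕ} (D : Fin (k + 1) → PMF α) :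
    indep D = (D 0).bind fun y => (indep fun i => D i.succ).map (Fin.cons y : _ → Fin (k + 1) → α) := by
  classical
  ext f
  rw [indep_apply, PMF.bind_apply, tsum_fintype, Fin.prod_univ_succ,
    Finset.sum_eq_single (f 0)]
  · congr 1
    rw [PMF.map_apply, tsum_fintype, Finset.sum_eq_single (Fin.tail f)]
    · rw [if_pos (Fin.cons_self_tail f).symm, indep_apply]; rfl
    · intro b _ hb
      rw [if_neg]
      intro h
      exact hb (by rw [h, Fin.tail_cons])
    · simp
  · intro b _ hb
    rw [PMF.map_apply, ENNReal.tsum_eq_zero.2, mul_zero]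
    intro a
    rw [if_neg]
    rintro rfl
    exact hb rfl
  · simp

theorem indep_fin_zero {α : Type} [Fintype α] (D : Fin 0 → PMF α) :
    indep D = PMF.pure Fin.elim0 := by
  ext f
  rw [indep_apply, PMF.pure_apply, if_pos (Subsingleton.elim _ _)]
  simp

/-! ### Building circuits -/

namespace Circuit

variable {J β κ : Type}

/-- Change the wires that a circuit reads. -/
def rename : {ι ι' : Type} → (ι → ι') → Circuit J β κ ι → Circuit J β κ ι'
  | _, _, σ, out o => out (σ ∘ o)
  | _, _, σ, const b c => const b (c.rename (Option.map σ))
  | _, _, σ, gate f a b c => gate f (σ a) (σ b) (c.rename (Option.map σ))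
  | _, _, σ, coin c => coin (c.rename (Option.map σ))
  | _, _, σ, query j m c => query j (σ m) (c.rename (Sum.map σ id))

theorem size_rename [Fintype β] [Fintype κ] {ι : Type} (c : Circuit J β κ ι) :
    ∀ {ι' : Type} (σ : ι → ι'), (c.rename σ).size = c.size := by
  induction c with
  | out o => intros; rfl
  | const b c ih => intros; simp only [rename, size, ih]
  | gate f a b c ih => intros; simp only [rename, size, ih]
  | coin c ih => intros; simp only [rename, size, ih]
  | query j m c ih => intros; simp only [rename, size, ih]

theorem run_rename (O : J → Bool → PMF (β → Bool)) {ι : Type} (c : Circuit J β κ ι) :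
    ∀ {ι' : Type} (σ : ι → ι') (v : ι' → Bool), (c.rename σ).run O v = c.run O (v ∘ σ) := by
  have key : ∀ {ι ι' : Type} (σ : ι → ι') (v : ι' → Bool) (r : Bool),
      (fun w : Option ι' => w.elim r v) ∘ Option.map σ = fun w => w.elim r (v ∘ σ) := by
    intros; funext w; cases w <;> rfl
  induction c with
  | out o => intros; rfl
  | const b c ih => intros; simp only [rename, run, ih, key]
  | gate f a b c ih => intros; simp only [rename, run, ih, key, Function.comp_apply]
  | coin c ih => intros; simp only [rename, run, ih, key]
  | query j m c ih =>
    intro ι' σ v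
    simp only [rename, run, ih, Function.comp_apply]
    congr 1; funext y; congr 1; funext w; cases w <;> rfl

/-- Run a plain circuit, and then run a circuit on its output. -/
def comp : {ι κ' : Type} → PlainCircuit ι κ' → Circuit J β κ κ' → Circuit J β κ ι
  | _, _, out o, next => next.rename o
  | _, _, const b c, next => const b (comp c next)
  | _, _, gate f a b c, next => gate f a b (comp c next)
  | _, _, coin c, next => coin (comp c next)
  | _, _, query j _ _, _ => j.elim

theorem size_comp_le [Fintype β] [Fintype κ] {ι κ' : Type} [Fintype κ'] (c : PlainCircuit ι κ')
    (next : Circuit J β κ κ') : (comp c next).size ≤ c.size + next.size := by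
  induction c with
  | out o => simp only [comp, size_rename, size]; omega
  | const b c ih => simp only [comp, size]; omega
  | gate f a b c ih => simp only [comp, size]; omega
  | coin c ih => simp only [comp, size]; omega
  | query j m c ih => exact j.elim

theorem run_comp (O : J → Bool → PMF (β → Bool)) {ι κ' : Type} (c : PlainCircuit ι κ')
    (next : Circuit J β κ κ') (v : ι → Bool) :
    (comp c next).run O v = (c.eval v).bind (next.run O) := by
  induction c with
  | out o => simp only [comp, run_rename, PlainCircuit.eval, run, PMF.pure_bind]; rfl
  | const b c ih => simp only [comp, run, ih, PlainCircuit.eval]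
  | gate f a b c ih => simp only [comp, run, ih, PlainCircuit.eval]
  | coin c ih => simp only [comp, run, ih, PlainCircuit.eval, PMF.bind_bind]
  | query j m c ih => exact j.elim

/-- A circuit that provides constant wires. -/
theorem exists_const [Fintype β] [Fintype κ] {ι ι' : Type} (g : ι' → ι ⊕ Bool)
    (next : Circuit J β κ ι') :
    ∃ c : Circuit J β κ ι, c.size ≤ next.size + 2 ∧ ∀ O v,
      c.run O v = next.run O fun w => Sum.elim v id (g w) := by
  refine ⟨const false (const true (next.rename fun w =>
    Sum.elim (fun i => some (some i)) (fun b => if b then none else some none) (g w))), ?_, ?_⟩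
  · simp only [size, size_rename]; omega
  · intro O v
    simp only [run, run_rename]
    congr 1; funext w
    simp only [Function.comp_apply]
    rcases g w with i | b
    · rfl
    · cases b <;> rfl

/-- A single oracle query with a constant message. -/
theorem exists_query [Fintype β] [Fintype κ] {ι : Type} (j : J) (m : Bool)
    (next : Circuit J β κ (ι ⊕ β)) :
    ∃ c : Circuit J β κ ι, c.size ≤ next.size + (2 + Fintype.card β) ∧ ∀ O v,
      c.run O v = (O j m).bind fun y => next.run O (Sum.elim v y) := by
  refine ⟨const m (query j none (next.rename (Sum.map some id))), ?_, ?_⟩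
  · simp only [size, size_rename]; omega
  · intro O v
    simp only [run, run_rename, Option.elim]
    congr 1; funext y; congr 1; funext w; cases w <;> rfl

/-- Independent repetition of sampling procedures. -/
theorem exists_indep [Fintype β] [Fintype κ] {γ : Type} [Fintype γ] [DecidableEq γ] (N : ℕ) :
    ∀ (k : ℕ) (D : Fin k → (J → Bool → PMF (β → Bool)) → PMF (γ → Bool))
    (_ : ∀ i (ι : Type) (next : Circuit J β κ (ι ⊕ γ)), ∃ c : Circuit J β κ ι,
      c.size ≤ next.size + N ∧
      ∀ O v, c.run O v = (D i O).bind fun y => next.run O (Sum.elim v y))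
    (ι : Type) (next : Circuit J β κ (ι ⊕ Fin k × γ)), ∃ c : Circuit J β κ ι,
      c.size ≤ next.size + k * N ∧
      ∀ O v, c.run O v =
        (indep fun i => D i O).bind fun y => next.run O (Sum.elim v fun w => y w.1 w.2)
  | 0, D, _, ι, next => by
    refine ⟨next.rename (Sum.elim id fun w => w.1.elim0), ?_, ?_⟩
    · simp [size_rename]
    · intro O v
      rw [indep_fin_zero, PMF.pure_bind, run_rename]
      congr 1; funext w
      rcases w with w | w
      · rfl
      · exact w.1.elim0
  | k + 1, D, h, ι, next => by
    -- Circuits are built backwards: the tail is sampled by a circuit that already has sample 0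
    -- among its wires, and that circuit is the continuation for sampling 0.
    obtain ⟨c, hc, hr⟩ := exists_indep N k (fun i => D i.succ) (fun i => h i.succ) (ι ⊕ γ)
      (next.rename (Sum.elim (fun i => .inl (.inl i)) fun w =>
        (Fin.cases (motive := fun _ => (ι ⊕ γ) ⊕ Fin k × γ) (.inl (.inr w.2))
          (fun i => .inr (i, w.2)) w.1)))
    obtain ⟨c', hc', hr'⟩ := h 0 ι c
    refine ⟨c', ?_, ?_⟩
    · rw [size_rename] at hc
      rw [Nat.succ_mul]
      omega
    · intro O v
      rw [hr', indep_fin_succ, PMF.bind_bind]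
      congr 1; funext y
      rw [hr, PMF.bind_map]
      congr 1; funext z
      simp only [Function.comp_apply]
      rw [run_rename]
      congr 1; funext w
      rcases w with w | ⟨i, w⟩
      · rfl
      · refine Fin.cases ?_ (fun i => ?_) i <;> rfl

/-- All the oracle queries that encrypt a matrix of constant messages. -/
theorem exists_query_matrix [Fintype β] [DecidableEq β] [Fintype κ] {ι : Type} {n d : ℕ}
    (e : Fin n → J) (X : Fin n → Fin d → Bool) (next : Circuit J β κ (ι ⊕ Fin n × Fin d × β)) :
    ∃ c : Circuit J β κ ι, c.size ≤ next.size + n * (d * (2 + Fintype.card β)) ∧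
      ∀ O v, c.run O v = (indep fun i => indep fun j => O (e i) (X i j)).bind fun y =>
        next.run O (Sum.elim v fun w => y w.1 w.2.1 w.2.2) := by
  obtain ⟨c, hc, hr⟩ := exists_indep (κ := κ) (γ := Fin d × β) (d * (2 + Fintype.card β)) n
    (fun i O => (indep fun j => O (e i) (X i j)).map fun y w => y w.1 w.2) (by
      intro i ι next
      obtain ⟨c, hc, hr⟩ := exists_indep (κ := κ) (γ := β) (2 + Fintype.card β) d
        (fun j O => O (e i) (X i j)) (fun j ι next => exists_query (e i) (X i j) next) ι next
      refine ⟨c, hc, fun O v => ?_⟩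
      rw [hr, PMF.bind_map]
      rfl) ι next
  refine ⟨c, hc, fun O v => ?_⟩
  rw [hr, indep_map, PMF.bind_map]
  rfl

/-- A layer of gates with three inputs each. -/
theorem exists_layer [Fintype β] [Fintype κ] {ι : Type} :
    ∀ (m : ℕ) (f g : Fin m → Bool → Bool → Bool) (x y z : Fin m → ι)
    (next : Circuit J β κ (ι ⊕ Fin m)), ∃ c : Circuit J β κ ι, c.size ≤ next.size + 2 * m ∧
      ∀ O v, c.run O v = next.run O
        (Sum.elim v fun i => g i (f i (v (x i)) (v (y i))) (v (z i)))
  | 0, f, g, x, y, z, next => by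
    refine ⟨next.rename (Sum.elim id fun w => w.elim0), by simp [size_rename], fun O v => ?_⟩
    rw [run_rename]
    congr 1; funext w
    rcases w with w | w
    · rfl
    · exact w.elim0
  | m + 1, f, g, x, y, z, next => by
    obtain ⟨c, hc, hr⟩ := exists_layer m (fun i => f i.succ) (fun i => g i.succ)
      (fun i => x i.succ) (fun i => y i.succ) (fun i => z i.succ)
      (gate (f 0) (.inl (x 0)) (.inl (y 0)) (gate (g 0) none (some (.inl (z 0)))
        (next.rename (Sum.elim (fun i => some (some (.inl i)))
          (Fin.cases none fun i => some (some (.inr i)))))))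
    refine ⟨c, ?_, fun O v => ?_⟩
    · simp only [size, size_rename] at hc
      omega
    · rw [hr]
      simp only [run, run_rename]
      congr 1; funext w
      rcases w with w | i
      · rfl
      · refine Fin.cases ?_ (fun i => ?_) i <;> rfl

/-- Given a unary counter with the value `m`, test whether `m` plus the number of satisfied
literals in a list reaches the threshold `t`. -/
theorem exists_counter [Fintype β] {ι : Type} (t : ℕ) (φ : ι → Bool → Bool) (L : List ι) :
    ∃ c : Circuit J β Unit (ι ⊕ Fin (t + 1)), c.size ≤ 1 + L.length * (2 * (t + 1)) ∧
      ∀ O v (m : ℕ), c.run O (Sum.elim v fun k => decide ((k : ℕ) ≤ m)) =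
        PMF.pure fun _ => decide (t ≤ m + L.countP fun a => φ a (v a)) := by
  induction L with
  | nil =>
    refine ⟨out fun _ => .inr (Fin.last t), by simp [size], fun O v m => ?_⟩
    simp [run]
  | cons a L ih =>
    obtain ⟨c, hc, hr⟩ := ih
    -- Wire k of the counter holds [k ≤ m]. A satisfied literal shifts the counter: the new wire k
    -- is the old one or the old wire k - 1. For k = 0 the truncated subtraction reads wire 0, whose
    -- value the test `k == 0` overrides.
    obtain ⟨c', hc', hr'⟩ := exists_layer (J := J) (β := β) (ι := ι ⊕ Fin (t + 1)) (t + 1)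
      (fun k s r => φ a s && ((k : ℕ) == 0 || r)) (fun _ => or) (fun _ => .inl a)
      (fun k => .inr ⟨(k : ℕ) - 1, by omega⟩) (fun k => .inr k)
      (c.rename (Sum.map .inl id))
    refine ⟨c', ?_, fun O v m => ?_⟩
    · rw [size_rename] at hc'
      rw [List.length_cons, Nat.succ_mul]
      omega
    · rw [hr', run_rename]
      have := hr O v (m + if φ a (v a) then 1 else 0)
      convert this using 2
      · funext w
        rcases w with w | k
        · rfl
        · simp only [Function.comp_apply, Sum.map_inr, Sum.elim_inr, Sum.elim_inl, id]
          rw [Bool.eq_iff_iff]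
          rcases k with ⟨k, hk⟩
          rcases k with _ | k <;> by_cases h : φ a (v a) <;> simp [h]; omega
      · rw [List.countP_cons]
        funext _
        congr 1
        rw [eq_iff_iff]
        split_ifs <;> omega

/-- Threshold tests have small circuits. -/
theorem exists_threshold [Fintype β] {ι : Type} (t : ℕ) (φ : ι → Bool → Bool) (L : List ι) :
    ∃ c : Circuit J β Unit ι, c.size ≤ 3 + L.length * (2 * (t + 1)) ∧
      ∀ O v, c.run O v = PMF.pure fun _ => decide (t ≤ L.countP fun a => φ a (v a)) := by
  obtain ⟨c, hc, hr⟩ := exists_counter (J := J) (β := β) t φ L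
  obtain ⟨c', hc', hr'⟩ := exists_const (ι := ι)
    (Sum.elim .inl fun k : Fin (t + 1) => .inr (decide ((k : ℕ) ≤ 0))) c
  refine ⟨c', by omega, fun O v => ?_⟩
  have := hr O v 0
  rw [zero_add] at this
  rw [hr', ← this]
  congr 1; funext w
  rcases w with w | k <;> rfl

end Circuit

/-! ### Rounding fixed-point numbers to bits. -/

/-- The disjunction of the two leading bits of a fixed-point
representation, which tells whether the number is at least `1 / 2`. -/
def leadingBit {b : ℕ} (v : Fin (b + 1) → Bool) : Bool := v (Fin.last b) || v ⟨b - 1, by omega⟩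

theorem half_le_fixedPoint {b : ℕ} {v : Fin (b + 1) → Bool} (h : leadingBit v = true) :
    1 / 2 ≤ fixedPoint v := by
  refine le_min (by norm_num) ?_
  rw [div_le_div_iff₀ (by norm_num) (by positivity), one_mul]
  have key : ∀ i : Fin (b + 1), v i = true →
      (2 : ℝ) ^ (i : ℕ) ≤ ∑ k, if v k then (2 : ℝ) ^ (k : ℕ) else 0 := by
    intro i hi
    have := Finset.single_le_sum (f := fun k : Fin (b + 1) => if v k then (2 : ℝ) ^ (k : ℕ) else 0)
      (fun k _ => by positivity) (Finset.mem_univ i)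
    simpa [hi] using this
  rw [leadingBit, Bool.or_eq_true] at h
  rcases h with h | h
  · have := key _ h
    rw [Fin.val_last] at this
    have h2 : (0 : ℝ) < 2 ^ b := by positivity
    linarith
  · have := key _ h
    rcases b with _ | b
    · rw [pow_zero] at this ⊢
      linarith
    · simp only [Nat.add_sub_cancel] at this
      rw [pow_succ]; linarith

/-- Without the two leading bits the numerator is at most a geometric sum, which stays below half of
the denominator. If there are no fractional bits, both positions read by `leadingBit` coincide. -/
theorem fixedPoint_lt_half {b : ℕ} {v : Fin (b + 1) → Bool} (h : leadingBit v = false) :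
    fixedPoint v < 1 / 2 := by
  refine min_lt_of_right_lt ?_
  rw [div_lt_div_iff₀ (by positivity) (by norm_num), one_mul]
  rw [leadingBit, Bool.or_eq_false_iff] at h
  rcases b with _ | b
  · have h1 : v 0 = false := h.1
    rw [Fin.sum_univ_one, h1]
    norm_num
  · rw [Fin.sum_univ_castSucc, h.1, Fin.sum_univ_castSucc]
    have h2 : v (Fin.last b).castSucc = false := h.2
    rw [h2]
    simp only [Bool.false_eq_true, if_false, add_zero, Fin.val_castSucc]
    have h3 : ∑ k : Fin b, (if v k.castSucc.castSucc then (2 : ℝ) ^ (k : ℕ) else 0) ≤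
        ∑ k : Fin b, (2 : ℝ) ^ (k : ℕ) :=
      Finset.sum_le_sum fun k _ => by
        split_ifs
        · exact le_rfl
        · positivity
    rw [Fin.sum_univ_eq_sum_range (fun k => (2 : ℝ) ^ k) b, geom_sum_eq (by norm_num)] at h3
    rw [pow_succ]
    linarith

/-! ### A fingerprinting code -/

/-- A bit as a real number. -/
def bitVal (b : Bool) : ℝ := if b then 1 else 0

theorem bitVal_nonneg (b : Bool) : 0 ≤ bitVal b := by cases b <;> norm_num [bitVal]

/-- The probability of a bit under the Bernoulli distribution with mean `p`. -/
def bern (p : ℝ) (b : Bool) : ℝ := if b then p else 1 - p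

theorem bern_nonneg {p : ℝ} (h₀ : 0 ≤ p) (h₁ : p ≤ 1) (b : Bool) : 0 ≤ bern p b := by
  cases b <;> simp [bern] <;> linarith

theorem sum_bern (p : ℝ) : ∑ b, bern p b = 1 := by simp [bern]

/-! ### The distribution of a single column. -/

section column
variable {n : ℕ}

/-- The probability of a bit string under independent Bernoulli bits with mean `p`. -/
def bernProd (p : ℝ) (x : Fin n → Bool) : ℝ := ∏ i, bern p (x i)

theorem bernProd_nonneg {p : ℝ} (h₀ : 0 ≤ p) (h₁ : p ≤ 1) (x : Fin n → Bool) :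
    0 ≤ bernProd p x := Finset.prod_nonneg fun i _ => bern_nonneg h₀ h₁ (x i)

theorem sum_bernProd (p : ℝ) : ∑ x : Fin n → Bool, bernProd p x = 1 := by
  have h := Finset.prod_univ_sum (fun _ : Fin n => (Finset.univ : Finset Bool))
    (fun _ b => bern p b)
  rw [Fintype.piFinset_univ] at h
  simp only [bernProd]
  rw [← h]
  simp only [sum_bern, Finset.prod_const_one]

theorem sum_bernProd_mul_bitVal (p : ℝ) (i : Fin n) :
    ∑ x : Fin n → Bool, bernProd p x * bitVal (x i) = p := by
  have h := sum_prod_resample (fun (_ : Fin n) b => bern p b) (fun _ b => bern p b) i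
    (fun _ _ => rfl) (sum_bern p) (fun x => bitVal (x i))
  simp only [bernProd]
  rw [h]
  have h2 : ∑ a, bern p a * bitVal a = p := by simp [bern, bitVal]
  simp only [Function.update_self, h2]
  rw [← Finset.sum_mul]
  have := sum_bernProd (n := n) p
  simp only [bernProd] at this
  rw [this, one_mul]

theorem continuous_bernProd (x : Fin n → Bool) : Continuous fun p => bernProd p x := by
  unfold bernProd
  refine continuous_finsetProd _ fun i _ => ?_
  unfold bern
  cases x i <;> simp <;> fun_prop

/-- The logarithmic derivative of each factor is (x_i - p)/(p(1-p)). This is the source of the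
density 1/(p(1-p)) in `columnWeight`. -/
theorem hasDerivAt_bernProd (x : Fin n → Bool) {p : ℝ} (h₀ : 0 < p) (h₁ : p < 1) :
    HasDerivAt (fun p => bernProd p x)
      (bernProd p x * (∑ i, (bitVal (x i) - p)) / (p * (1 - p))) p := by
  have h1 : ∀ i : Fin n, HasDerivAt (fun p => bern p (x i))
      (bern p (x i) * (bitVal (x i) - p) / (p * (1 - p))) p := by
    intro i
    have hp : p * (1 - p) ≠ 0 := (mul_pos h₀ (by linarith)).ne'
    cases x i
    · have : bern p false * (bitVal false - p) / (p * (1 - p)) = -1 := by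
        rw [div_eq_iff hp]; simp [bern, bitVal]; ring
      rw [this]
      exact (hasDerivAt_id p).const_sub 1
    · have : bern p true * (bitVal true - p) / (p * (1 - p)) = 1 := by
        rw [div_eq_iff hp]; simp [bern, bitVal]
      rw [this]
      exact hasDerivAt_id p
  have h2 := HasDerivAt.fun_finsetProd (u := Finset.univ) fun i _ => h1 i
  refine h2.congr_deriv (Eq.symm ?_)
  rw [Finset.mul_sum, Finset.sum_div]
  refine Finset.sum_congr rfl fun i _ => ?_
  rw [smul_eq_mul, bernProd, ← Finset.mul_prod_erase _ _ (Finset.mem_univ i)]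
  ring

/-- Columns of the code: the kind of the column (`some true` and `some false` are mostly ones and
mostly zeros, `none` is a column with a random mean), the bits of the users, and reference bits
with the same distribution. -/
abbrev Column (n : ℕ) : Type := Option Bool × (Fin n → Bool) × (Fin n → Bool)

/-- The joint probability of the bits and the reference bits for a column with mean `p`. -/
def pairWeight (p : ℝ) (x y : Fin n → Bool) : ℝ := bernProd p x * bernProd p y

/-- The normalization of the distribution of columns. -/
def columnNorm : ℝ := 2 + ∫ p in (1 / 20 : ℝ)..(19 / 20), 1 / (p * (1 - p))

/-- The distribution of columns. -/
def columnWeight : Column n → ℝ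
  | (some true, x, y) => pairWeight (19 / 20) x y / columnNorm
  | (some false, x, y) => pairWeight (1 / 20) x y / columnNorm
  | (none, x, y) =>
    (∫ p in (1 / 20 : ℝ)..(19 / 20), pairWeight p x y / (p * (1 - p))) / columnNorm

theorem two_le_columnNorm : 2 ≤ columnNorm := by
  have : 0 ≤ ∫ p in (1 / 20 : ℝ)..(19 / 20), 1 / (p * (1 - p)) := by
    refine intervalIntegral.integral_nonneg (by norm_num) fun p hp => ?_
    have h1 : 0 ≤ p := by linarith [hp.1]
    have h2 : 0 ≤ 1 - p := by linarith [hp.2]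
    positivity
  unfold columnNorm
  linarith

theorem columnNorm_pos : 0 < columnNorm := by linarith [two_le_columnNorm]

/-- Truncating the means to [1/20, 19/20] keeps the density away from its poles. -/
theorem intervalIntegrable_div {f : ℝ → ℝ} (hf : Continuous f) :
    IntervalIntegrable (fun p => f p / (p * (1 - p))) MeasureTheory.volume (1 / 20) (19 / 20) := by
  refine ContinuousOn.intervalIntegrable ?_
  refine hf.continuousOn.div (by fun_prop) fun p hp => ?_
  rw [Set.uIcc_of_le (by norm_num)] at hp
  exact (mul_pos (by linarith [hp.1]) (by linarith [hp.2])).ne'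

theorem continuous_pairWeight (x y : Fin n → Bool) : Continuous fun p => pairWeight p x y :=
  (continuous_bernProd x).mul (continuous_bernProd y)

theorem pairWeight_nonneg {p : ℝ} (h₀ : 0 ≤ p) (h₁ : p ≤ 1) (x y : Fin n → Bool) :
    0 ≤ pairWeight p x y := mul_nonneg (bernProd_nonneg h₀ h₁ x) (bernProd_nonneg h₀ h₁ y)

theorem columnWeight_nonneg (c : Column n) : 0 ≤ columnWeight c := by
  obtain ⟨_ | _ | _, x, y⟩ := c
  · refine div_nonneg (intervalIntegral.integral_nonneg (by norm_num) fun p hp => ?_)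
      columnNorm_pos.le
    have h1 : 0 ≤ p := by linarith [hp.1]
    have h2 : 0 ≤ 1 - p := by linarith [hp.2]
    exact div_nonneg (pairWeight_nonneg h1 (by linarith) x y) (mul_nonneg h1 h2)
  · exact div_nonneg (pairWeight_nonneg (by norm_num) (by norm_num) x y) columnNorm_pos.le
  · exact div_nonneg (pairWeight_nonneg (by norm_num) (by norm_num) x y) columnNorm_pos.le

theorem sum_pairWeight (p : ℝ) (x : Fin n → Bool) : ∑ y, pairWeight p x y = bernProd p x := by
  simp only [pairWeight]
  rw [← Finset.mul_sum, sum_bernProd, mul_one]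

theorem sum_column {R : Type*} [AddCommMonoid R] (F : Column n → R) :
    ∑ c, F c = ∑ x, ∑ y, F (none, x, y) +
      (∑ x, ∑ y, F (some true, x, y) + ∑ x, ∑ y, F (some false, x, y)) := by
  rw [Fintype.sum_prod_type, Fintype.sum_option, Fintype.sum_bool]
  simp only [Fintype.sum_prod_type]

/-- Moves finite sums inside the integral, so that columns with a random mean can be evaluated for
each fixed p. -/
theorem sum_columnWeight_none (g : (Fin n → Bool) → (Fin n → Bool) → ℝ) :
    ∑ x, ∑ y, columnWeight (none, x, y) * g x y =
      (∫ p in (1 / 20 : ℝ)..(19 / 20),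
        (∑ x, ∑ y, pairWeight p x y * g x y) / (p * (1 - p))) / columnNorm := by
  have h1 : ∀ p : ℝ, (∑ x, ∑ y, pairWeight p x y * g x y) / (p * (1 - p)) =
      ∑ x, ∑ y, pairWeight p x y / (p * (1 - p)) * g x y := by
    intro p
    simp only [Finset.sum_div]
    refine Finset.sum_congr rfl fun x _ => Finset.sum_congr rfl fun y _ => by ring
  have h2 : ∀ x y : Fin n → Bool, IntervalIntegrable
      (fun p => pairWeight p x y / (p * (1 - p)) * g x y) MeasureTheory.volume (1 / 20) (19 / 20) :=
    fun x y => (intervalIntegrable_div (continuous_pairWeight x y)).mul_const _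
  have h3 : ∀ x : Fin n → Bool, IntervalIntegrable
      (fun p => ∑ y, pairWeight p x y / (p * (1 - p)) * g x y)
      MeasureTheory.volume (1 / 20) (19 / 20) := by
    intro x
    have := IntervalIntegrable.sum Finset.univ fun y _ => h2 x y
    rwa [Finset.sum_fn] at this
  simp only [h1]
  rw [intervalIntegral.integral_finsetSum fun x _ => h3 x, Finset.sum_div]
  refine Finset.sum_congr rfl fun x _ => ?_
  rw [intervalIntegral.integral_finsetSum fun y _ => h2 x y, Finset.sum_div]
  refine Finset.sum_congr rfl fun y _ => ?_
  rw [intervalIntegral.integral_mul_const]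
  simp only [columnWeight]
  ring

theorem sum_columnWeight : ∑ c : Column n, columnWeight c = 1 := by
  have h := sum_columnWeight_none (n := n) fun _ _ => 1
  simp only [mul_one, sum_pairWeight, sum_bernProd] at h
  rw [sum_column, h]
  simp only [columnWeight, ← Finset.sum_div, sum_pairWeight, sum_bernProd]
  rw [← add_div, ← add_div, div_eq_one_iff_eq columnNorm_pos.ne', columnNorm]
  ring

/-- The contribution of a column to the score of a user. -/
def columnScore (c : Column n) (i : Fin n) : ℝ :=
  if c.1 = none then bitVal (c.2.1 i) - bitVal (c.2.2 i) else 0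

/-- The sign of a column. -/
def columnSign (c : Column n) : ℝ :=
  match c.1 with
  | none => 0
  | some true => 1
  | some false => -1

/-- Exchange the bit and the reference bit of a user. -/
def swapAt (i : Fin n) (c : Column n) : Column n :=
  (c.1, Function.update c.2.1 i (c.2.2 i), Function.update c.2.2 i (c.2.1 i))

theorem swapAt_swapAt (i : Fin n) : Function.Involutive (swapAt i) := by
  intro c; simp [swapAt]

theorem pairWeight_swap (p : ℝ) (x y : Fin n → Bool) (i : Fin n) :
    pairWeight p (Function.update x i (y i)) (Function.update y i (x i)) = pairWeight p x y := by
  simp only [pairWeight, bernProd]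
  rw [← Finset.prod_mul_distrib, ← Finset.prod_mul_distrib]
  refine Finset.prod_congr rfl fun k _ => ?_
  by_cases h : k = i
  · subst h; simp [mul_comm]
  · simp [Function.update_of_ne h]

/-- Given the mean, a bit and its reference bit are independent with the same law. This exchange
symmetry replaces conditioning on the mean wherever a score has to vanish on average or be
symmetric. -/
theorem columnWeight_swapAt (i : Fin n) (c : Column n) :
    columnWeight (swapAt i c) = columnWeight c := by
  obtain ⟨_ | _ | _, x, y⟩ := c <;> simp only [columnWeight, swapAt, pairWeight_swap]

theorem sum_columnWeight_swapAt (i : Fin n) (F : Column n → ℝ) :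
    ∑ c, columnWeight c * F c = ∑ c, columnWeight c * F (swapAt i c) :=
  Fintype.sum_equiv (swapAt_swapAt i).toPerm _ _ fun c => by
    rw [Function.Involutive.coe_toPerm, swapAt_swapAt i c, columnWeight_swapAt]

theorem columnScore_swapAt_self (i : Fin n) (c : Column n) :
    columnScore (swapAt i c) i = -columnScore c i := by
  simp only [columnScore, swapAt, Function.update_self]
  split_ifs <;> simp

theorem columnScore_swapAt_of_ne {i k : Fin n} (h : k ≠ i) (c : Column n) :
    columnScore (swapAt i c) k = columnScore c k := by
  simp only [columnScore, swapAt, Function.update_of_ne h]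

theorem abs_columnScore_le (c : Column n) (i : Fin n) : |columnScore c i| ≤ 1 := by
  simp only [columnScore, bitVal]
  split_ifs <;> norm_num

/-- The exchange at `i` preserves the weight and `F` but negates the score, so the mean equals its
own negative. -/
theorem sum_columnWeight_score_eq_zero (i : Fin n) (F : Column n → ℝ)
    (hF : ∀ c, F (swapAt i c) = F c) : ∑ c, columnWeight c * (F c * columnScore c i) = 0 := by
  have h := sum_columnWeight_swapAt i fun c => F c * columnScore c i
  simp only [hF, columnScore_swapAt_self, mul_neg, Finset.sum_neg_distrib] at h
  linarith

/-- Fundamental theorem of calculus. The endpoints are the means of the two biased kinds of columns,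
so the boundary terms are exactly the weights of those columns, up to normalization. -/
theorem integral_bernProd (x : Fin n → Bool) :
    ∫ p in (1 / 20 : ℝ)..(19 / 20), bernProd p x * (∑ i, (bitVal (x i) - p)) / (p * (1 - p)) =
      bernProd (19 / 20) x - bernProd (1 / 20) x := by
  refine intervalIntegral.integral_eq_sub_of_hasDerivAt (f := fun p => bernProd p x)
    (fun p hp => ?_) (intervalIntegrable_div ((continuous_bernProd x).mul (by fun_prop)))
  rw [Set.uIcc_of_le (by norm_num)] at hp
  exact hasDerivAt_bernProd x (by linarith [hp.1]) (by linarith [hp.2])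

/-- The sum of all scores of a column has the same conditional mean as its sign, given the bits of
all users. -/
theorem sum_columnWeight_allScores (f : (Fin n → Bool) → ℝ) :
    ∑ c : Column n, columnWeight c * (f c.2.1 * (∑ i, columnScore c i - columnSign c)) = 0 := by
  -- Averaging over the reference bits replaces each of them by the mean p.
  have h1 : ∀ (p : ℝ) (x : Fin n → Bool),
      ∑ y, pairWeight p x y * (f x * (∑ i, (bitVal (x i) - bitVal (y i)))) =
        f x * (bernProd p x * ∑ i, (bitVal (x i) - p)) := by
    intro p x
    have h2 : ∀ y : Fin n → Bool,
        pairWeight p x y * (f x * (∑ i, (bitVal (x i) - bitVal (y i)))) =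
        f x * bernProd p x * ∑ i, (bernProd p y * bitVal (x i) - bernProd p y * bitVal (y i)) := by
      intro y
      have : ∑ i, (bernProd p y * bitVal (x i) - bernProd p y * bitVal (y i)) =
          bernProd p y * ∑ i, (bitVal (x i) - bitVal (y i)) := by
        rw [Finset.mul_sum]; exact Finset.sum_congr rfl fun i _ => by ring
      rw [this, pairWeight]; ring
    simp only [h2]
    rw [← Finset.mul_sum, Finset.sum_comm, mul_assoc]
    congr 2
    refine Finset.sum_congr rfl fun i _ => ?_
    rw [Finset.sum_sub_distrib, ← Finset.sum_mul, sum_bernProd, sum_bernProd_mul_bitVal, one_mul]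
  have h3 := sum_columnWeight_none (n := n)
    fun x y => f x * (∑ i, (bitVal (x i) - bitVal (y i)))
  simp only [h1] at h3
  rw [sum_column]
  simp only [columnScore, columnSign, if_true, sub_zero, reduceCtorEq, if_false,
    Finset.sum_const_zero, zero_sub]
  rw [h3]
  have h4 : ∀ p : ℝ, (∑ x : Fin n → Bool, f x * (bernProd p x * ∑ i, (bitVal (x i) - p))) /
      (p * (1 - p)) =
      ∑ x : Fin n → Bool, f x * (bernProd p x * (∑ i, (bitVal (x i) - p)) / (p * (1 - p))) := by
    intro p
    rw [Finset.sum_div]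
    exact Finset.sum_congr rfl fun x _ => by ring
  have h6 : ∀ x : Fin n → Bool, IntervalIntegrable (fun p => f x *
      (bernProd p x * (∑ i, (bitVal (x i) - p)) / (p * (1 - p))))
      MeasureTheory.volume (1 / 20) (19 / 20) := fun x =>
    (intervalIntegrable_div ((continuous_bernProd x).mul (by fun_prop))).const_mul (f x)
  simp only [h4]
  rw [intervalIntegral.integral_finsetSum fun x _ => h6 x]
  simp only [intervalIntegral.integral_const_mul, integral_bernProd, columnWeight]
  have h5 : ∀ (p a : ℝ) (x : Fin n → Bool), ∑ y, pairWeight p x y / columnNorm * (f x * a) =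
      bernProd p x / columnNorm * (f x * a) := by
    intro p a x
    rw [← Finset.sum_mul, ← Finset.sum_div, sum_pairWeight]
  simp only [h5]
  rw [Finset.sum_div, ← Finset.sum_add_distrib, ← Finset.sum_add_distrib]
  exact Finset.sum_eq_zero fun x _ => by ring

/-- The deviation of the scores of a set of users from the sign of the column. -/
def columnDev (C : Finset (Fin n)) (c : Column n) : ℝ := ∑ i ∈ C, columnScore c i - columnSign c

/-- The deviation has mean zero, given the bits of the users in the set. -/
theorem sum_columnWeight_dev (C : Finset (Fin n)) (f : (Fin n → Bool) → ℝ)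
    (hf : ∀ x x', (∀ i ∈ C, x i = x' i) → f x = f x') :
    ∑ c : Column n, columnWeight c * (f c.2.1 * columnDev C c) = 0 := by
  have h1 := sum_columnWeight_allScores f
  -- Exchanging the bits of a user outside `C` does not affect `f`, so the scores of such users can
  -- be dropped from the identity for all users.
  have h2 : ∑ i ∈ Cᶜ, ∑ c : Column n, columnWeight c * (f c.2.1 * columnScore c i) = 0 := by
    refine Finset.sum_eq_zero fun i hi => ?_
    refine sum_columnWeight_score_eq_zero i (fun c => f c.2.1) fun c => hf _ _ fun k hk => ?_
    have : k ≠ i := by rintro rfl; exact Finset.mem_compl.1 hi hk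
    simp [swapAt, Function.update_of_ne this]
  rw [Finset.sum_comm] at h2
  have h3 : ∑ c : Column n, columnWeight c * (f c.2.1 * columnDev C c) =
      ∑ c : Column n, columnWeight c * (f c.2.1 * (∑ i, columnScore c i - columnSign c)) -
        ∑ c : Column n, ∑ i ∈ Cᶜ, columnWeight c * (f c.2.1 * columnScore c i) := by
    rw [← Finset.sum_sub_distrib]
    refine Finset.sum_congr rfl fun c _ => ?_
    rw [← Finset.mul_sum, ← Finset.mul_sum, columnDev, ← Finset.sum_add_sum_compl C]
    ring
  rw [h3, h1, h2, sub_zero]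

theorem sum_columnWeight_mul_le {F : Column n → ℝ} {a : ℝ} (h : ∀ c, F c ≤ a) :
    ∑ c, columnWeight c * F c ≤ a := by
  calc ∑ c, columnWeight c * F c ≤ ∑ c : Column n, columnWeight c * a :=
        Finset.sum_le_sum fun c _ => mul_le_mul_of_nonneg_left (h c) (columnWeight_nonneg c)
    _ = a := by rw [← Finset.sum_mul, sum_columnWeight, one_mul]

/-- The scores of different users are orthogonal by the exchange symmetry, so each user in `C`
contributes at most one, and the sign contributes at most one more. -/
theorem sum_columnWeight_dev_sq (C : Finset (Fin n)) :
    ∑ c : Column n, columnWeight c * columnDev C c ^ 2 ≤ C.card + 1 := by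
  have h1 : ∀ c : Column n, columnDev C c ^ 2 =
      ∑ i ∈ C, ∑ k ∈ C, columnScore c k * columnScore c i + columnSign c ^ 2 := by
    intro c
    have : columnDev C c ^ 2 =
        (∑ i ∈ C, columnScore c i) ^ 2 + columnSign c ^ 2 -
          2 * (∑ i ∈ C, columnScore c i) * columnSign c := by rw [columnDev]; ring
    -- Scores are supported on columns with a random mean, signs on the biased ones.
    have h2 : (∑ i ∈ C, columnScore c i) * columnSign c = 0 := by
      obtain ⟨_ | _ | _, x, y⟩ := c <;> simp [columnScore, columnSign]
    rw [this, mul_assoc, h2, mul_zero, sub_zero, sq (∑ i ∈ C, _), Finset.sum_mul_sum,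
      Finset.sum_comm]
  simp only [h1, mul_add, Finset.sum_add_distrib, Finset.mul_sum]
  refine add_le_add ?_ ?_
  · rw [Finset.sum_comm, Finset.card_eq_sum_ones, Nat.cast_sum]
    refine Finset.sum_le_sum fun i hi => ?_
    rw [Finset.sum_comm, Finset.sum_eq_single_of_mem i hi]
    · rw [Nat.cast_one]
      refine sum_columnWeight_mul_le fun c => ?_
      have := abs_columnScore_le c i
      rw [← sq]
      exact (sq_le_one_iff_abs_le_one _).2 this
    · intro k _ hk
      exact sum_columnWeight_score_eq_zero i (fun c => columnScore c k)
        fun c => columnScore_swapAt_of_ne hk c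
  · refine sum_columnWeight_mul_le fun c => ?_
    obtain ⟨_ | _ | _, x, y⟩ := c <;> norm_num [columnSign]

/-- The average of the bits of the users. -/
def bitAvg (x : Fin n → Bool) : ℝ := (∑ i, bitVal (x i)) / n

/-- The contribution of a column to a lower bound for the correlation of a roughly correct answer
with the signs of the columns. -/
def columnGain (c : Column n) : ℝ :=
  match c.1 with
  | none => 0
  | some true => if 3 / 5 ≤ bitAvg c.2.1 then 1 else 0
  | some false => if 2 / 5 ≤ bitAvg c.2.1 then -1 else 0

theorem sum_bernProd_bitAvg (hn : 0 < n) (p : ℝ) :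
    ∑ x : Fin n → Bool, bernProd p x * bitAvg x = p := by
  have h0 : (n : ℝ) ≠ 0 := by exact_mod_cast hn.ne'
  simp only [bitAvg, mul_div_assoc', Finset.mul_sum]
  rw [← Finset.sum_div, Finset.sum_comm]
  simp only [sum_bernProd_mul_bitVal, Finset.sum_const, Finset.card_univ, Fintype.card_fin,
    nsmul_eq_mul]
  field_simp

theorem bitAvg_nonneg (x : Fin n → Bool) : 0 ≤ bitAvg x :=
  div_nonneg (Finset.sum_nonneg fun _ _ => bitVal_nonneg _) (Nat.cast_nonneg _)

theorem bitAvg_le_one (x : Fin n → Bool) : bitAvg x ≤ 1 := by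
  refine div_le_one_of_le₀ ?_ (Nat.cast_nonneg _)
  calc ∑ i, bitVal (x i) ≤ ∑ _i : Fin n, (1 : ℝ) :=
        Finset.sum_le_sum fun i _ => by cases x i <;> norm_num [bitVal]
    _ = n := by simp

/-- Markov's inequality for both biased kinds, by affine bounds on the indicators. A mostly-one
column has average at least 3/5 with probability at least 7/8. A mostly-zero column has average at
least 2/5 with probability at most 1/8. Their difference gives 3/4. -/
theorem le_sum_columnWeight_gain (hn : 0 < n) :
    3 / 4 / columnNorm ≤ ∑ c : Column n, columnWeight c * columnGain c := by
  rw [sum_column]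
  simp only [columnGain, mul_zero, Finset.sum_const_zero, zero_add, columnWeight]
  have h5 : ∀ (p a : ℝ) (x : Fin n → Bool), ∑ y, pairWeight p x y / columnNorm * a =
      bernProd p x * a / columnNorm := by
    intro p a x
    rw [← Finset.sum_mul, ← Finset.sum_div, sum_pairWeight]; ring
  change _ ≤ ∑ x : Fin n → Bool, ∑ y, pairWeight (19 / 20) x y / columnNorm *
      (if 3 / 5 ≤ bitAvg x then 1 else 0) +
    ∑ x : Fin n → Bool, ∑ y, pairWeight (1 / 20) x y / columnNorm *
      (if 2 / 5 ≤ bitAvg x then -1 else 0)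
  simp only [h5]
  rw [← Finset.sum_div, ← Finset.sum_div, ← add_div]
  refine div_le_div_of_nonneg_right ?_ columnNorm_pos.le
  have h6 : ∀ p : ℝ, ∀ a b : ℝ, ∑ x : Fin n → Bool, bernProd p x * (a * bitAvg x + b) =
      a * p + b := by
    intro p a b
    have : ∀ x : Fin n → Bool, bernProd p x * (a * bitAvg x + b) =
      a * (bernProd p x * bitAvg x) + b * bernProd p x := fun x => by ring
    simp only [this]
    rw [Finset.sum_add_distrib, ← Finset.mul_sum, ← Finset.mul_sum, sum_bernProd,
      sum_bernProd_bitAvg hn, mul_one]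
  have h7 : 7 / 8 ≤ ∑ x : Fin n → Bool, bernProd (19 / 20) x *
      (if 3 / 5 ≤ bitAvg x then 1 else 0) := by
    calc (7 / 8 : ℝ) = ∑ x : Fin n → Bool, bernProd (19 / 20) x * (5 / 2 * bitAvg x + -3 / 2) := by
          rw [h6]; norm_num
      _ ≤ _ := by
          refine Finset.sum_le_sum fun x _ => mul_le_mul_of_nonneg_left ?_
            (bernProd_nonneg (by norm_num) (by norm_num) x)
          have := bitAvg_le_one x
          split_ifs with h <;> linarith
  have h8 : -1 / 8 ≤ ∑ x : Fin n → Bool, bernProd (1 / 20) x *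
      (if 2 / 5 ≤ bitAvg x then -1 else 0) := by
    calc (-1 / 8 : ℝ) = ∑ x : Fin n → Bool, bernProd (1 / 20) x * (-5 / 2 * bitAvg x + 0) := by
          rw [h6]; norm_num
      _ ≤ _ := by
          refine Finset.sum_le_sum fun x _ => mul_le_mul_of_nonneg_left ?_
            (bernProd_nonneg (by norm_num) (by norm_num) x)
          have := bitAvg_nonneg x
          split_ifs with h <;> linarith
  linarith

end column

/-! ### Codes with independent columns: accurate answers and accusations. -/

section code
variable {n d : ℕ}

/-- The mean of a function of a code whose columns are independent. -/
def codeMean (F : (Fin d → Column n) → ℝ) : ℝ := ∑ code, (∏ j, columnWeight (code j)) * F code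

theorem codeMean_mono {F G : (Fin d → Column n) → ℝ} (h : ∀ code, F code ≤ G code) :
    codeMean F ≤ codeMean G :=
  Finset.sum_le_sum fun code _ => mul_le_mul_of_nonneg_left (h code)
    (Finset.prod_nonneg fun _ _ => columnWeight_nonneg _)

theorem codeMean_const (a : ℝ) : codeMean (fun _ : Fin d → Column n => a) = a := by
  have h := Finset.prod_univ_sum (fun _ : Fin d => (Finset.univ : Finset (Column n)))
    (fun _ c => columnWeight c)
  rw [Fintype.piFinset_univ] at h
  rw [codeMean, ← Finset.sum_mul, ← h]
  simp only [sum_columnWeight, Finset.prod_const_one, one_mul]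

theorem codeMean_add (F G : (Fin d → Column n) → ℝ) :
    codeMean (fun code => F code + G code) = codeMean F + codeMean G := by
  simp only [codeMean, mul_add, Finset.sum_add_distrib]

theorem codeMean_const_mul (a : ℝ) (F : (Fin d → Column n) → ℝ) :
    codeMean (fun code => a * F code) = a * codeMean F := by
  simp only [codeMean]
  rw [Finset.mul_sum]
  exact Finset.sum_congr rfl fun _ _ => by ring

theorem codeMean_sum {ι : Type*} (s : Finset ι) (F : ι → (Fin d → Column n) → ℝ) :
    codeMean (fun code => ∑ i ∈ s, F i code) = ∑ i ∈ s, codeMean (F i) := by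
  simp only [codeMean, Finset.mul_sum]
  rw [Finset.sum_comm]

theorem codeMean_resample (j : Fin d) (F : (Fin d → Column n) → ℝ) :
    codeMean F = codeMean fun code => ∑ c, columnWeight c * F (Function.update code j c) :=
  sum_prod_resample (fun _ c => columnWeight c) (fun _ c => columnWeight c) j (fun _ _ => rfl)
    sum_columnWeight F

theorem codeMean_column (j : Fin d) (f : Column n → ℝ) :
    codeMean (fun code => f (code j)) = ∑ c, columnWeight c * f c := by
  rw [codeMean_resample j]
  simp only [Function.update_self]
  exact codeMean_const _

/-- Resampling one column suffices to make a mean vanish. The cross terms of the second moments are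
treated in this way. -/
theorem codeMean_eq_zero (j : Fin d) (F : (Fin d → Column n) → ℝ)
    (h : ∀ code, ∑ c, columnWeight c * F (Function.update code j c) = 0) : codeMean F = 0 := by
  rw [codeMean_resample j]
  simp only [h]
  exact codeMean_const 0

/-- The messages of the users. -/
def codeMessages (code : Fin d → Column n) : Fin n → Fin d → Bool := fun i j => (code j).2.1 i

/-- The correlation of an answer with the codeword of a user. -/
def score (code : Fin d → Column n) (i : Fin n) (b : Fin d → Bool) : ℝ :=
  ∑ j, bitVal (b j) * columnScore (code j) i

/-- The answer is correct in all columns with a clear majority. -/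
def RoughlyCorrect (X : Fin n → Fin d → Bool) (b : Fin d → Bool) : Prop :=
  ∀ j, (3 / 5 ≤ bitAvg (fun i => X i j) → b j = true) ∧
    (bitAvg (fun i => X i j) < 2 / 5 → b j = false)

/-- Orthogonality of the contributions of distinct columns removes the cross terms. Here `κ` plays
the role of the conditional law of the answer, so independence of the contributions is not needed.
-/
theorem codeMean_sq_sum_le {β : Type*} [Fintype β] (κ : (Fin d → Column n) → β → ℝ)
    (N : (Fin d → Column n) → β → Fin d → ℝ) {a : ℝ}
    (h₁ : ∀ j k, j ≠ k → codeMean (fun code => ∑ b, κ code b * (N code b j * N code b k)) = 0)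
    (h₂ : ∀ j, codeMean (fun code => ∑ b, κ code b * N code b j ^ 2) ≤ a) :
    codeMean (fun code => ∑ b, κ code b * (∑ j, N code b j) ^ 2) ≤ d * a := by
  have h3 : ∀ code, ∑ b, κ code b * (∑ j, N code b j) ^ 2 =
      ∑ j, ∑ k, ∑ b, κ code b * (N code b j * N code b k) := by
    intro code
    rw [Finset.sum_congr rfl fun j _ => Finset.sum_comm, Finset.sum_comm]
    refine Finset.sum_congr rfl fun b _ => ?_
    simp only [← Finset.mul_sum, sq, ← Finset.sum_mul]
  simp only [h3, codeMean_sum]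
  calc _ = ∑ j, codeMean (fun code => ∑ b, κ code b * N code b j ^ 2) := by
        refine Finset.sum_congr rfl fun j _ => ?_
        rw [Finset.sum_eq_single j]
        · simp only [codeMean_sum, sq]
        · intro k _ hk
          rw [← codeMean_sum]
          exact h₁ j k hk.symm
        · simp
    _ ≤ ∑ _j : Fin d, a := Finset.sum_le_sum fun j _ => h₂ j
    _ = d * a := by simp

/-- If the answer depends only on the codewords of a small set of users, then it is unlikely that
it is roughly correct and that no user has a high score. -/
theorem codeMean_prob_no_accusation_le (hn : 0 < n) (hd : 0 < d) (C : Finset (Fin n))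
    (K : (Fin n → Fin d → Bool) → PMF (Fin d → Bool))
    (hK : ∀ X X', (∀ i ∈ C, X i = X' i) → K X = K X') {T : ℝ}
    (hT : C.card * T < 3 / 4 / columnNorm * d / 2) :
    codeMean (fun code => prob (K (codeMessages code))
      {b | RoughlyCorrect (codeMessages code) b ∧ ∀ i, score code i b ≤ T}) ≤
      16 * (C.card + 2) / ((3 / 4 / columnNorm) ^ 2 * d) := by
  classical
  set a : ℝ := 3 / 4 / columnNorm with ha
  have ha0 : 0 < a := div_pos (by norm_num) columnNorm_pos
  have hd0 : (0 : ℝ) < d := by exact_mod_cast hd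
  set m : ℝ := ∑ c : Column n, columnWeight c * columnGain c with hm
  have ham : a ≤ m := le_sum_columnWeight_gain hn
  set κ : (Fin d → Column n) → (Fin d → Bool) → ℝ :=
    fun code b => (K (codeMessages code) b).toReal with hκ
  have hκ1 : ∀ code, ∑ b, κ code b = 1 := fun code => sum_toReal _
  have hκ0 : ∀ code b, 0 ≤ κ code b := fun code b => ENNReal.toReal_nonneg
  have hm0 : ∑ c : Column n, columnWeight c * (columnGain c - m) = 0 := by
    simp only [mul_sub, Finset.sum_sub_distrib]
    rw [← Finset.sum_mul, sum_columnWeight, one_mul, ← hm, sub_self]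
  have hgain : codeMean (fun code => ∑ b, κ code b * (∑ j, (columnGain (code j) - m)) ^ 2) ≤
      d * 1 := by
    refine codeMean_sq_sum_le κ (fun code _ j => columnGain (code j) - m) (fun j k hjk => ?_)
      fun j => ?_
    · simp only [← Finset.sum_mul, hκ1, one_mul]
      refine codeMean_eq_zero j _ fun code => ?_
      simp only [Function.update_self, Function.update_of_ne hjk.symm, ← mul_assoc]
      rw [← Finset.sum_mul, hm0, zero_mul]
    · simp only [← Finset.sum_mul, hκ1, one_mul]
      rw [codeMean_column j fun c => (columnGain c - m) ^ 2]
      have h1 : ∑ c : Column n, columnWeight c * (columnGain c - m) ^ 2 =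
          ∑ c : Column n, columnWeight c * columnGain c ^ 2 - m ^ 2 := by
        have : ∀ c : Column n, columnWeight c * (columnGain c - m) ^ 2 =
            columnWeight c * columnGain c ^ 2 - 2 * m * (columnWeight c * columnGain c) +
              m ^ 2 * columnWeight c := fun c => by ring
        simp only [this, Finset.sum_add_distrib, Finset.sum_sub_distrib, ← Finset.mul_sum]
        rw [sum_columnWeight, ← hm]; ring
      have h2 : ∑ c : Column n, columnWeight c * columnGain c ^ 2 ≤ 1 := by
        refine sum_columnWeight_mul_le fun c => ?_
        simp only [columnGain]
        split
        · norm_num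
        · split_ifs <;> norm_num
        · split_ifs <;> norm_num
      rw [h1]
      linarith [sq_nonneg m]
  -- The answer depends on all columns, but it sees column j only through the bits of users in `C`.
  -- Given these, the deviation of column j has mean zero, so cross terms vanish.
  have hdev : codeMean (fun code => ∑ b, κ code b *
      (∑ j, bitVal (b j) * columnDev C (code j)) ^ 2) ≤ d * (C.card + 1) := by
    refine codeMean_sq_sum_le κ (fun code b j => bitVal (b j) * columnDev C (code j))
      (fun j k hjk => ?_) fun j => ?_
    · rw [codeMean_sum]
      refine Finset.sum_eq_zero fun b _ => codeMean_eq_zero j _ fun code => ?_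
      simp only [Function.update_self, Function.update_of_ne hjk.symm]
      -- The messages ignore the kind of the column and the reference bits, so `none` and the second
      -- `x` are placeholders.
      have := sum_columnWeight_dev C (fun x => κ (Function.update code j (none, x, x)) b *
        (bitVal (b j) * bitVal (b k) * columnDev C (code k))) (by
          intro x x' hxx
          simp only [hκ]
          rw [hK _ _ fun i hi => ?_]
          funext j'
          by_cases hj : j' = j
          · subst hj; simpa [codeMessages] using hxx i hi
          · simp [codeMessages, Function.update_of_ne hj])
      rw [← this]
      refine Finset.sum_congr rfl fun c _ => ?_
      have hc : κ (Function.update code j c) b =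
          κ (Function.update code j (none, c.2.1, c.2.1)) b := by
        simp only [hκ]
        rw [hK _ _ fun i hi => ?_]
        funext j'
        by_cases hj : j' = j
        · subst hj; simp [codeMessages]
        · simp [codeMessages, Function.update_of_ne hj]
      rw [hc]; ring
    · calc _ ≤ codeMean (fun code : Fin d → Column n => columnDev C (code j) ^ 2) := by
            refine codeMean_mono fun code => ?_
            calc _ ≤ ∑ b, κ code b * columnDev C (code j) ^ 2 := by
                  refine Finset.sum_le_sum fun b _ => mul_le_mul_of_nonneg_left ?_ (hκ0 _ _)
                  cases b j <;> simp [bitVal, sq_nonneg]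
              _ = _ := by rw [← Finset.sum_mul, hκ1, one_mul]
        _ ≤ _ := by
            rw [codeMean_column j fun c => columnDev C c ^ 2]
            exact sum_columnWeight_dev_sq C
  have hA : 0 < a * d / 4 := by positivity
  -- Chebyshev for two sums at once. If both are smaller than ad/4 in absolute value, then the
  -- scores in `C` sum to more than ad - ad/4 - ad/4 = ad/2, which exceeds |C|T, so some score
  -- exceeds T.
  have hpt : ∀ code : Fin d → Column n, prob (K (codeMessages code))
      {b | RoughlyCorrect (codeMessages code) b ∧ ∀ i, score code i b ≤ T} ≤
      ((a * d / 4) ^ 2)⁻¹ * (∑ b, κ code b * (∑ j, (columnGain (code j) - m)) ^ 2 +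
        ∑ b, κ code b * (∑ j, bitVal (b j) * columnDev C (code j)) ^ 2) := by
    intro code
    rw [prob_eq_sum, ← Finset.sum_add_distrib, Finset.mul_sum]
    refine Finset.sum_le_sum fun b _ => ?_
    have hre : ((a * d / 4) ^ 2)⁻¹ * (κ code b * (∑ j, (columnGain (code j) - m)) ^ 2 +
        κ code b * (∑ j, bitVal (b j) * columnDev C (code j)) ^ 2) =
        κ code b * (((∑ j, (columnGain (code j) - m)) ^ 2 +
          (∑ j, bitVal (b j) * columnDev C (code j)) ^ 2) / (a * d / 4) ^ 2) := by ring
    rw [hre]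
    refine mul_le_mul_of_nonneg_left ?_ (hκ0 code b)
    split_ifs with hb
    swap
    · positivity
    obtain ⟨hb1, hb2⟩ := hb
    rw [one_le_div (by positivity)]
    by_contra! hlt
    have hs1 : (∑ j, (columnGain (code j) - m)) ^ 2 < (a * d / 4) ^ 2 := by
      linarith [sq_nonneg (∑ j, bitVal (b j) * columnDev C (code j))]
    have hs2 : (∑ j, bitVal (b j) * columnDev C (code j)) ^ 2 < (a * d / 4) ^ 2 := by
      linarith [sq_nonneg (∑ j, (columnGain (code j) - m))]
    have hs1' := (abs_lt.1 (sq_lt_sq.1 hs1 |>.trans_eq (abs_of_pos hA))).1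
    have hs2' := (abs_lt.1 (sq_lt_sq.1 hs2 |>.trans_eq (abs_of_pos hA))).1
    have hsum : ∑ i ∈ C, score code i b ≤ C.card * T := by
      calc _ ≤ ∑ _i ∈ C, T := Finset.sum_le_sum fun i _ => hb2 i
        _ = _ := by simp
    have hdecomp : ∑ i ∈ C, score code i b =
        ∑ j, bitVal (b j) * columnDev C (code j) + ∑ j, bitVal (b j) * columnSign (code j) := by
      simp only [score]
      rw [Finset.sum_comm, ← Finset.sum_add_distrib]
      refine Finset.sum_congr rfl fun j _ => ?_
      rw [← Finset.mul_sum, columnDev]; ring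
    -- Rough correctness fixes the bit when the average agrees with the bias. Otherwise the worst
    -- value is 0 in a mostly-one column and -1 in a mostly-zero one.
    have hsign : ∑ j, columnGain (code j) ≤ ∑ j, bitVal (b j) * columnSign (code j) := by
      refine Finset.sum_le_sum fun j _ => ?_
      obtain ⟨h1, h2⟩ := hb1 j
      simp only [codeMessages] at h1 h2
      rcases hcj : code j with ⟨_ | _ | _, x, y⟩
      · simp [columnGain, columnSign]
      · rw [hcj] at h2
        simp only [columnGain, columnSign]
        split_ifs with h
        · cases b j <;> simp [bitVal]
        · rw [h2 (not_le.1 h)]; simp [bitVal]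
      · rw [hcj] at h1
        simp only [columnGain, columnSign]
        split_ifs with h
        · rw [h1 h]; simp [bitVal]
        · cases b j <;> simp [bitVal]
    rw [Finset.sum_sub_distrib] at hs1'
    simp only [Finset.sum_const, Finset.card_univ, Fintype.card_fin, nsmul_eq_mul] at hs1'
    have hmd : a * d ≤ d * m := by
      rw [mul_comm]; exact mul_le_mul_of_nonneg_left ham hd0.le
    linarith
  refine (codeMean_mono hpt).trans ?_
  rw [codeMean_const_mul, codeMean_add]
  refine (mul_le_mul_of_nonneg_left (add_le_add hgain hdev) (by positivity)).trans_eq ?_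
  field_simp
  ring

/-- A user whose codeword is independent of the answer is unlikely to have a high score. -/
theorem codeMean_prob_score_le (hd : 0 < d) (i : Fin n)
    (K : (Fin n → Fin d → Bool) → PMF (Fin d → Bool))
    (hK : ∀ X X', (∀ k, k ≠ i → X k = X' k) → K X = K X') (T : ℝ) (hT : 0 ≤ T) :
    codeMean (fun code => prob (K (codeMessages code)) {b | T < score code i b}) ≤
      Real.exp (-(T ^ 2 / (2 * d))) := by
  classical
  have hd0 : (0 : ℝ) < d := by exact_mod_cast hd
  set κ : (Fin d → Column n) → (Fin d → Bool) → ℝ :=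
    fun code b => (K (codeMessages code) b).toReal with hκ
  have hκ1 : ∀ code, ∑ b, κ code b = 1 := fun code => sum_toReal _
  have hκ0 : ∀ code b, 0 ≤ κ code b := fun code b => ENNReal.toReal_nonneg
  -- The minimizer of the Chernoff exponent u²d/2 - uT.
  set u : ℝ := T / d with hu
  have hu0 : 0 ≤ u := by positivity
  -- Symmetrization: exchanging the bits of user `i` in any set of columns preserves the code and
  -- the law of the answer, so the scores carry independent random signs and cosh t ≤ exp(t²/2)
  -- applies in each column.
  let sw : (Fin d → Bool) → (Fin d → Column n) → Fin d → Column n :=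
    fun s code j => if s j then swapAt i (code j) else code j
  have hinv : ∀ s, Function.Involutive (sw s) := by
    intro s code; funext j
    by_cases h : s j <;> simp [sw, h, swapAt_swapAt i (code j)]
  have hw : ∀ s code, ∏ j, columnWeight (sw s code j) = ∏ j, columnWeight (code j) := by
    intro s code
    refine Finset.prod_congr rfl fun j _ => ?_
    by_cases h : s j <;> simp [sw, h, columnWeight_swapAt]
  have hsw : ∀ s F, codeMean F = codeMean fun code => F (sw s code) := by
    intro s F
    refine Fintype.sum_equiv (hinv s).toPerm _ _ fun code => ?_
    change _ = (∏ j, columnWeight (sw s code j)) * F (sw s (sw s code))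
    rw [hinv s code, hw]
  have hκsw : ∀ s code b, κ (sw s code) b = κ code b := by
    intro s code b
    simp only [hκ]
    rw [hK _ _ fun k hk => ?_]
    funext j
    by_cases h : s j <;> simp [sw, h, codeMessages, swapAt, Function.update_of_ne hk]
  set F : (Fin d → Column n) → ℝ := fun code => ∑ b, κ code b * Real.exp (u * score code i b)
    with hF
  have hmgf : codeMean F ≤ Real.exp (u ^ 2 / 2) ^ d := by
    have h1 : (2 : ℝ) ^ d * codeMean F = codeMean fun code => ∑ s : Fin d → Bool, F (sw s code) := by
      rw [codeMean_sum Finset.univ fun s code => F (sw s code),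
        ← Finset.sum_congr rfl fun s _ => hsw s F]
      simp
    have h2 : ∀ code, ∑ s : Fin d → Bool, F (sw s code) ≤
        2 ^ d * Real.exp (u ^ 2 / 2) ^ d := by
      intro code
      simp only [hF, hκsw]
      rw [Finset.sum_comm]
      simp only [← Finset.mul_sum]
      calc _ ≤ ∑ b, κ code b * (2 ^ d * Real.exp (u ^ 2 / 2) ^ d) := by
            refine Finset.sum_le_sum fun b _ => mul_le_mul_of_nonneg_left ?_ (hκ0 _ _)
            have h3 : ∀ s, Real.exp (u * score (sw s code) i b) =
                ∏ j, Real.exp (u * (bitVal (b j) *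
                  (if s j then -columnScore (code j) i else columnScore (code j) i))) := by
              intro s
              rw [← Real.exp_sum, score, Finset.mul_sum]
              congr 1
              refine Finset.sum_congr rfl fun j _ => ?_
              by_cases h : s j <;> simp [sw, h, columnScore_swapAt_self]
            have h4 := Finset.prod_univ_sum (fun _ : Fin d => (Finset.univ : Finset Bool))
              (fun j s => Real.exp (u * (bitVal (b j) *
                  (if s then -columnScore (code j) i else columnScore (code j) i))))
            rw [Fintype.piFinset_univ] at h4
            simp only [h3]
            rw [← h4, ← mul_pow]
            calc _ ≤ ∏ _j : Fin d, (2 * Real.exp (u ^ 2 / 2)) := by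
                  refine Finset.prod_le_prod (fun j _ => Finset.sum_nonneg fun _ _ =>
                    (Real.exp_pos _).le) fun j _ => ?_
                  set t : ℝ := u * (bitVal (b j) * columnScore (code j) i) with ht
                  have h5 : ∑ s : Bool, Real.exp (u * (bitVal (b j) *
                      (if s then -columnScore (code j) i else columnScore (code j) i))) =
                      2 * Real.cosh t := by
                    rw [Fintype.sum_bool, Real.cosh_eq]
                    simp only [if_true, mul_neg, Bool.false_eq_true, if_false, ← ht]
                    ring
                  rw [h5]
                  refine mul_le_mul_of_nonneg_left ((Real.cosh_le_exp_half_sq t).trans ?_)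
                    (by norm_num)
                  refine Real.exp_le_exp.2 (div_le_div_of_nonneg_right ?_ (by norm_num))
                  refine sq_le_sq.2 ?_
                  rw [ht, abs_mul, abs_mul]
                  refine mul_le_of_le_one_right (abs_nonneg u)
                    (mul_le_one₀ ?_ (abs_nonneg _) (abs_columnScore_le (code j) i))
                  cases b j <;> simp [bitVal]
              _ = _ := by simp
        _ = _ := by rw [← Finset.sum_mul, hκ1, one_mul]
    have h3 := codeMean_mono h2
    rw [← h1, codeMean_const] at h3
    exact le_of_mul_le_mul_left h3 (by positivity)
  have hpt : ∀ code, prob (K (codeMessages code)) {b | T < score code i b} ≤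
      Real.exp (-(u * T)) * F code := by
    intro code
    rw [prob_eq_sum, hF, Finset.mul_sum]
    refine Finset.sum_le_sum fun b _ => ?_
    rw [mul_left_comm, ← Real.exp_add]
    refine mul_le_mul_of_nonneg_left ?_ (hκ0 code b)
    split_ifs with h
    · rw [Real.one_le_exp_iff]
      have : T < score code i b := h
      nlinarith
    · positivity
  refine (codeMean_mono hpt).trans ?_
  rw [codeMean_const_mul]
  refine (mul_le_mul_of_nonneg_left hmgf (Real.exp_pos _).le).trans_eq ?_
  rw [← Real.exp_nat_mul, ← Real.exp_add, hu]
  congr 1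
  field_simp
  ring

end code

/-! ### Growth and uniform security bounds -/

/-- `g` grows at least linearly. -/
def AtLeastLinear (g : ℕ → ℝ) : Prop := ∃ c : ℝ, 0 < c ∧ ∀ᶠ l : ℕ in atTop, c * (l : ℝ) ≤ g l

section growth
variable {g : ℕ → ℝ} {f f' : ℕ → ℕ}

theorem AtLeastLinear.tendsto (hg : AtLeastLinear g) : Tendsto g atTop atTop := by
  obtain ⟨c, hc, h⟩ := hg
  exact tendsto_atTop_mono' atTop h (tendsto_natCast_atTop_atTop.const_mul_atTop hc)

theorem AtLeastLinear.one_le (hg : AtLeastLinear g) : ∀ᶠ l in atTop, 1 ≤ g l :=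
  hg.tendsto.eventually_ge_atTop 1

theorem PolyBounded.mono (hf : PolyBounded g f) (h : ∀ l, f' l ≤ f l) : PolyBounded g f' := by
  obtain ⟨k, hk⟩ := hf
  refine ⟨k, IsBigO.trans (IsBigO.of_bound 1 (Eventually.of_forall fun l => ?_)) hk⟩
  rw [Real.norm_natCast, Real.norm_natCast, one_mul]
  exact_mod_cast h l

theorem PolyBounded.mul (hf : PolyBounded g f) (hf' : PolyBounded g f') :
    PolyBounded g fun l => f l * f' l := by
  obtain ⟨k, hk⟩ := hf
  obtain ⟨k', hk'⟩ := hf'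
  refine ⟨k + k', ?_⟩
  simpa only [Nat.cast_mul, pow_add] using hk.mul hk'

theorem isBigO_pow_of_le (hg : AtLeastLinear g) {k k' : ℕ} (h : k ≤ k') :
    (fun l => g l ^ k) =O[atTop] fun l => g l ^ k' := by
  refine IsBigO.of_bound 1 ?_
  filter_upwards [hg.one_le] with l hl
  rw [one_mul, norm_pow, norm_pow, Real.norm_of_nonneg (by linarith)]
  exact pow_le_pow_right₀ hl h

theorem PolyBounded.add (hg : AtLeastLinear g) (hf : PolyBounded g f) (hf' : PolyBounded g f') :
    PolyBounded g fun l => f l + f' l := by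
  obtain ⟨k, hk⟩ := hf
  obtain ⟨k', hk'⟩ := hf'
  refine ⟨k + k', ?_⟩
  simpa only [Nat.cast_add] using (hk.trans (isBigO_pow_of_le hg (Nat.le_add_right k k'))).add
    (hk'.trans (isBigO_pow_of_le hg (Nat.le_add_left k' k)))

theorem polyBounded_const (a : ℕ) : PolyBounded g fun _ => a :=
  ⟨0, by simpa using isBigO_const_const (a : ℝ) (one_ne_zero : (1 : ℝ) ≠ 0) atTop⟩

theorem isBigO_natCast (hg : AtLeastLinear g) : (fun l : ℕ => (l : ℝ)) =O[atTop] g := by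
  obtain ⟨c, hc, h⟩ := hg
  refine IsBigO.of_bound c⁻¹ ?_
  filter_upwards [h] with l hl
  rw [Real.norm_natCast, inv_mul_eq_div, le_div_iff₀ hc, mul_comm]
  exact hl.trans (le_abs_self _)

theorem polyBounded_id (hg : AtLeastLinear g) : PolyBounded g fun l => l :=
  ⟨1, by simpa using isBigO_natCast hg⟩

theorem PolyBounded.of_linear (hg : AtLeastLinear g) (hf : PolyBounded (fun l => (l : ℝ)) f) :
    PolyBounded g f := by
  obtain ⟨k, hk⟩ := hf
  exact ⟨k, hk.trans ((isBigO_natCast hg).pow k)⟩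

/-- Allows a union bound over polynomially many users, each with a negligible error. -/
theorem PolyBounded.tendsto_mul_zero (hf : PolyBounded g f) {ν : ℕ → ℝ}
    (hν : SuperpolynomialDecay atTop g ν) :
    Tendsto (fun l => (f l : ℝ) * ν l) atTop (nhds 0) := by
  obtain ⟨k, hk⟩ := hf
  exact (hk.mul (isBigO_refl ν atTop)).trans_tendsto (hν k)

end growth

/-- If a quantity is negligible for every choice of parameters, then it is negligible uniformly. -/
theorem exists_uniform_negligible {g : ℕ → ℝ} {I : ℕ → Type*} [∀ l, Nonempty (I l)]
    (gap : ∀ l, I l → ℝ) (h₀ : ∀ l i, 0 ≤ gap l i) (h₁ : ∀ l i, gap l i ≤ 1)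
    (h : ∀ choice : ∀ l, I l, SuperpolynomialDecay atTop g fun l => gap l (choice l)) :
    ∃ ν : ℕ → ℝ, SuperpolynomialDecay atTop g ν ∧ ∀ l i, gap l i ≤ ν l := by
  have hb : ∀ l, BddAbove (Set.range (gap l)) := fun l => ⟨1, by rintro _ ⟨i, rfl⟩; exact h₁ l i⟩
  have hsup : ∀ l i, gap l i ≤ ⨆ i, gap l i := fun l i => le_ciSup (hb l) i
  -- The supremum need not be attained, but a factor 2 suffices: a sequence of near-maximizers is
  -- one admissible choice, and its gap dominates half the supremum.
  have hex : ∀ l, ∃ i, (⨆ i, gap l i) ≤ 2 * gap l i := by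
    intro l
    by_cases hpos : 0 < ⨆ i, gap l i
    · obtain ⟨i, hi⟩ := exists_lt_of_lt_ciSup (half_lt_self hpos)
      exact ⟨i, by linarith⟩
    · obtain ⟨i⟩ := (inferInstance : Nonempty (I l))
      exact ⟨i, by linarith [h₀ l i]⟩
  choose ch hch using hex
  refine ⟨fun l => ⨆ i, gap l i, ((h ch).const_mul 2).trans_abs_le fun l => ?_, hsup⟩
  rw [abs_of_nonneg ((h₀ l (ch l)).trans (hsup l _))]
  exact (hch l).trans (le_abs_self _)

theorem abs_sub_prob_le_one {a b : ℝ} (ha : 0 ≤ a) (ha' : a ≤ 1) (hb : 0 ≤ b) (hb' : b ≤ 1) :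
    |a - b| ≤ 1 := abs_le.2 ⟨by linarith, by linarith⟩

theorem nonempty_circuit_size_le {J β ι : Type} [Fintype β] {N : ℕ} (hN : 2 ≤ N) :
    Nonempty {B : Circuit J β Unit ι // B.size ≤ N} :=
  ⟨⟨.const false (.out fun _ => none), by simpa [Circuit.size] using hN⟩⟩

/-! ### Security with one negligible bound for all circuits of bounded size. -/

section security
variable {P : MILRScheme} {Γ : ℝ → ℝ}

/-- A single user suffices here, since messages are erased for one user at a time and all other data
are hard-wired into the circuit. -/
theorem MILRScheme.MultiSemanticSecure.uniform (h : P.MultiSemanticSecure Γ) {N : ℕ → ℕ}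
    (hN : PolyBounded (fun l => Γ l) N) (hN₂ : ∀ l, 2 ≤ N l) :
    ∃ ν : ℕ → ℝ, SuperpolynomialDecay atTop (fun l : ℕ => Γ l) ν ∧
      ∀ l (B : Circuit (Fin 1) (Fin (P.cipherLen l)) Unit (Fin 1 × Fin (P.paramLen l))),
        B.size ≤ N l → |P.semanticGame false B - P.semanticGame true B| ≤ ν l := by
  have inst : ∀ l, Nonempty {B : Circuit (Fin 1) (Fin (P.cipherLen l)) Unit
      (Fin 1 × Fin (P.paramLen l)) // B.size ≤ N l} := fun l => nonempty_circuit_size_le (hN₂ l)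
  obtain ⟨ν, hν, hb⟩ := exists_uniform_negligible (g := fun l : ℕ => Γ l)
    (I := fun l => {B : Circuit (Fin 1) (Fin (P.cipherLen l)) Unit
      (Fin 1 × Fin (P.paramLen l)) // B.size ≤ N l})
    (fun l B => |P.semanticGame false B.1 - P.semanticGame true B.1|) (fun _ _ => abs_nonneg _)
    (fun l B => abs_sub_prob_le_one (prob_nonneg _ _) (prob_le_one _ _) (prob_nonneg _ _)
      (prob_le_one _ _))
    (fun ch => h (fun _ => 1) (polyBounded_const 1) (fun l => (ch l).1)
      (hN.mono fun l => (ch l).2))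
  exact ⟨ν, hν, fun l B hB => hb l ⟨B, hB⟩⟩

/-- The security notion fixes `J` before the circuit is chosen, so one `J` serves all small
circuits, hence all codes. -/
theorem MILRScheme.MultiLeakageSecure.uniform {τ : ℝ → ℝ → ℝ} (h : P.MultiLeakageSecure Γ τ)
    {n s : ℕ → ℕ} (hn : PolyBounded (fun l => Γ l) n) (hs : ∀ l, l ≠ 0 → s l ≤ n l * l)
    (F : ∀ l, (Fin (n l) → Bits l) → PMF (Bits (s l))) {N : ℕ → ℕ}
    (hN : PolyBounded (fun l => Γ l) N) (hN₂ : ∀ l, 2 ≤ N l) :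
    ∃ ν : ℕ → ℝ, SuperpolynomialDecay atTop (fun l : ℕ => Γ l) ν ∧ ∀ l, l ≠ 0 →
      ∃ J : (Fin (n l) → Bits l) → Bits (s l) → (Fin (n l) → Bits (P.paramLen l)) →
          PMF (Finset (Fin (n l))),
        (∀ x z p, ∀ S ∈ (J x z p).support, (n l : ℝ) - τ l (s l) ≤ S.card) ∧
        ∀ B : Circuit (Fin (n l)) (Fin (P.cipherLen l)) Unit
            (Fin (s l) ⊕ Fin (n l) × Fin (P.paramLen l)), B.size ≤ N l →
          |P.leakageGame false (F l) J B - P.leakageGame true (F l) J B| ≤ ν l := by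
  -- At `l = 0` the bound on the leakage length would force it to be zero, so the leakage is changed
  -- at this irrelevant value.
  let s' : ℕ → ℕ := fun l => match l with
    | 0 => 0
    | l + 1 => s (l + 1)
  let F' : ∀ l, (Fin (n l) → Bits l) → PMF (Bits (s' l)) := fun l => match l with
    | 0 => fun _ => PMF.pure fun _ => false
    | l + 1 => F (l + 1)
  obtain ⟨J, hJ, hB⟩ := h n hn s' (fun l => match l with
    | 0 => le_rfl
    | l + 1 => hs (l + 1) (Nat.succ_ne_zero l)) F'
  have inst : ∀ l, Nonempty {B : Circuit (Fin (n l)) (Fin (P.cipherLen l)) Unit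
      (Fin (s' l) ⊕ Fin (n l) × Fin (P.paramLen l)) // B.size ≤ N l} :=
    fun l => nonempty_circuit_size_le (hN₂ l)
  obtain ⟨ν, hν, hb⟩ := exists_uniform_negligible (g := fun l : ℕ => Γ l)
    (I := fun l => {B : Circuit (Fin (n l)) (Fin (P.cipherLen l)) Unit
      (Fin (s' l) ⊕ Fin (n l) × Fin (P.paramLen l)) // B.size ≤ N l})
    (fun l B => |P.leakageGame false (F' l) (J l) B.1 - P.leakageGame true (F' l) (J l) B.1|)
    (fun _ _ => abs_nonneg _)
    (fun l B => abs_sub_prob_le_one (prob_nonneg _ _) (prob_le_one _ _) (prob_nonneg _ _)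
      (prob_le_one _ _))
    (fun ch => hB (fun l => (ch l).1) (hN.mono fun l => (ch l).2))
  refine ⟨ν, hν, fun l hl => ?_⟩
  obtain ⟨l, rfl⟩ := Nat.exists_eq_succ_of_ne_zero hl
  exact ⟨J (l + 1), hJ (l + 1), fun B hB => hb (l + 1) ⟨B, hB⟩⟩

/-- A query and two datasets can be hard-wired into `Q`, with an empty state, so privacy holds
pointwise in them. The gap is the positive part of the privacy violation; the nonnegative bound `δ'`
keeps it at most one. -/
theorem DAAlgorithm.IsCDP.uniform {n d s : ℕ → ℕ} {A : DAAlgorithm P n d s} {ε : ℝ} {δ : ℕ → ℝ}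
    (h : A.IsCDP Γ ε δ) (hΓ : AtLeastLinear fun l => Γ l) (hn₀ : ∀ l, 0 < n l)
    (hn : PolyBounded (fun l => Γ l) n) (hd : PolyBounded (fun l => Γ l) d) {δ' : ℕ → ℝ} (hδ : ∀ l, δ (n l) ≤ δ' l)
    (hδ' : ∀ l, 0 ≤ δ' l) {N : ℕ → ℕ} (hN : PolyBounded (fun l => Γ l) N) (hN₂ : ∀ l, 2 ≤ N l) :
    ∃ ν : ℕ → ℝ, SuperpolynomialDecay atTop (fun l : ℕ => Γ l) ν ∧
      ∀ l (q : DAQuery P l (n l) (d l)) (D : Bool → Fin (n l) → Bits l)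
        (T : PlainCircuit (Fin (d l) × Fin (A.prec l + 1)) Unit),
        Neighboring (D false) (D true) → T.size ≤ N l →
        prob ((A.answer l (D false) q).bind T.eval) {t | t () = true} ≤
          Real.exp ε * prob ((A.answer l (D true) q).bind T.eval) {t | t () = true} + δ' l + ν l := by
  let I : ℕ → Type 1 := fun l => DAQuery P l (n l) (d l) ×
    {D : Bool → Fin (n l) → Bits l // Neighboring (D false) (D true)} ×
    {T : PlainCircuit (Fin (d l) × Fin (A.prec l + 1)) Unit // T.size ≤ N l}
  let G : ∀ l, I l → Bool → ℝ := fun l i b =>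
    prob ((A.answer l (i.2.1.1 b) i.1).bind i.2.2.1.eval) {t | t () = true}
  have key : ∀ ch : ∀ l, I l, ∃ ν : ℕ → ℝ, SuperpolynomialDecay atTop (fun l : ℕ => Γ l) ν ∧
      ∀ l, G l (ch l) false ≤ Real.exp ε * G l (ch l) true + δ (n l) + ν l := by
    intro ch
    let o : ∀ l, CDPChoiceIdx P l (n l) (d l) 0 → Bool := fun l =>
      Sum.elim (fun _ => false) (Sum.elim (ch l).1.toBits
        (Sum.elim (fun i => (ch l).2.1.1 false i.1 i.2) (fun i => (ch l).2.1.1 true i.1 i.2)))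
    have hQ : ∀ l, ∃ Q : PlainCircuit Empty (CDPChoiceIdx P l (n l) (d l) 0),
        Q.size ≤ Fintype.card (CDPChoiceIdx P l (n l) (d l) 0) + 2 ∧
        Q.eval Empty.elim = PMF.pure (o l) := by
      intro l
      obtain ⟨c, hc, hr⟩ := Circuit.exists_const (J := Empty) (β := Empty) (ι := Empty)
        (fun w => .inr (o l w)) (.out id)
      exact ⟨c, hc, hr _ _⟩
    choose Q hQs hQe using hQ
    let T : ∀ l, PlainCircuit (Fin 0 ⊕ Fin (d l) × Fin (A.prec l + 1)) Unit :=
      fun l => (ch l).2.2.1.rename .inr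
    have hQp : PolyBounded (fun l => Γ l) fun l => (Q l).size := by
      have hp : PolyBounded (fun l => Γ l) fun l =>
          (n l * P.paramLen l + n l * (d l * P.cipherLen l)) + (n l * l + n l * l) + 2 :=
        (((hn.mul (P.paramLen_poly.of_linear hΓ)).add hΓ
          (hn.mul (hd.mul (P.cipherLen_poly.of_linear hΓ)))).add hΓ
          ((hn.mul (polyBounded_id hΓ)).add hΓ (hn.mul (polyBounded_id hΓ)))).add hΓ
          (polyBounded_const 2)
      refine hp.mono fun l => (hQs l).trans (le_of_eq ?_)
      simp [CDPChoiceIdx, DAQueryIdx]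
    have hTp : PolyBounded (fun l => Γ l) fun l => (T l).size :=
      hN.mono fun l => (Circuit.size_rename _ _).trans_le (ch l).2.2.2
    obtain ⟨ν, hν, hle⟩ := h (fun _ => 0) Q T hQp hTp (by
      intro l o' ho'
      rw [hQe, PMF.mem_support_pure_iff] at ho'
      subst ho'
      exact (ch l).2.1.2)
    have hG : ∀ l b, A.cdpGame b (Q l) (T l) = G l (ch l) b := by
      intro l b
      simp only [DAAlgorithm.cdpGame, G, hQe, PMF.pure_bind]
      have h1 : CDPChoice.data (o l) b = (ch l).2.1.1 b := by cases b <;> rfl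
      have h2 : CDPChoice.query (o l) = (ch l).1 := rfl
      rw [h1, h2]
      congr 2
      funext a
      simp only [PlainCircuit.eval, T]
      rw [Circuit.run_rename]
      rfl
    refine ⟨ν, hν, fun l => ?_⟩
    rw [← hG, ← hG]
    exact hle l
  have inst : ∀ l, Nonempty (I l) := fun l =>
    ⟨⟨⟨fun _ _ => false, fun _ _ _ => false⟩, ⟨fun _ _ _ => false, ⟨⟨0, hn₀ l⟩, fun _ _ => rfl⟩⟩,
      (nonempty_circuit_size_le (hN₂ l)).some⟩⟩
  obtain ⟨ν, hν, hb⟩ := exists_uniform_negligible (g := fun l : ℕ => Γ l) (I := I)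
    (fun l i => max 0 (G l i false - Real.exp ε * G l i true - δ' l)) (fun _ _ => le_max_left _ _)
    (fun l i => max_le zero_le_one (by
      have h1 : G l i false ≤ 1 := prob_le_one _ _
      have h2 : 0 ≤ Real.exp ε * G l i true := mul_nonneg (Real.exp_pos _).le (prob_nonneg _ _)
      linarith [hδ' l]))
    (fun ch => by
      obtain ⟨ν, hν, hle⟩ := key ch
      refine hν.trans_abs_le fun l => ?_
      rw [abs_of_nonneg (le_max_left _ _)]
      refine max_le (abs_nonneg _) (le_trans ?_ (le_abs_self _))
      linarith [hle l, hδ l])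
  refine ⟨ν, hν, fun l q D T hD hT => ?_⟩
  have := (le_max_right _ _).trans (hb l ⟨q, ⟨D, hD⟩, ⟨T, hT⟩⟩)
  simp only [G] at this
  linarith

end security

/-! ### The adversaries -/

/-- Round every answer to a bit. -/
def roundBits {d b : ℕ} (a : Fin d × Fin (b + 1) → Bool) : Fin d → Bool :=
  fun j => leadingBit fun k => a (j, k)

/-- The thresholds 2/5 and 3/5 are 1/2 shifted by the permitted error 1/10. -/
theorem RoughlyCorrect.of_abs_le {n d b : ℕ} {X : Fin n → Fin d → Bool}
    {a : Fin d × Fin (b + 1) → Bool}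
    (h : ∀ j, |fixedPoint (fun k => a (j, k)) - bitAvg fun i => X i j| ≤ 1 / 10) :
    RoughlyCorrect X (roundBits a) := by
  intro j
  have hj := abs_le.1 (h j)
  constructor
  · intro h1
    by_contra h2
    have := fixedPoint_lt_half (Bool.eq_false_iff.2 h2)
    linarith [hj.1]
  · intro h1
    by_contra h2
    have := half_le_fixedPoint (Bool.not_eq_false _ ▸ h2 : leadingBit (fun k => a (j, k)) = true)
    linarith [hj.2]

/-- The number of coordinates that satisfy a list of literals. -/
def litCount {d : ℕ} (L : Fin d → Option Bool) (b : Fin d → Bool) : ℕ :=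
  (Finset.univ.filter fun j => L j = some (b j)).card

/-- A bound for the size of a circuit that rounds all answers and applies a threshold test. -/
def testSize (d : ℕ) : ℕ := 2 * d + (3 + d * (2 * (d + 2)))

/-- A predicate of the rounded answers that is computed by a circuit of size at most
`testSize d`. -/
def IsTest (d b : ℕ) (E : Set (Fin d → Bool)) : Prop :=
  ∃ T : PlainCircuit (Fin d × Fin (b + 1)) Unit, T.size ≤ testSize d ∧
    ∀ a, ∃ r : Bool, T.eval a = PMF.pure (fun _ => r) ∧ (r = true ↔ roundBits a ∈ E)

theorem isTest_litCount {d : ℕ} (b : ℕ) (L : Fin d → Option Bool) (t : ℕ) :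
    IsTest d b {x | t ≤ litCount L x} := by
  -- Capping the threshold at d + 1 keeps the circuit small and does not change the test, since at
  -- most d literals hold.
  obtain ⟨c, hc, hr⟩ := Circuit.exists_threshold (J := Empty) (β := Empty) (ι := Fin d)
    (min t (d + 1)) (fun j v => decide (L j = some v)) (List.finRange d)
  obtain ⟨c', hc', hr'⟩ := Circuit.exists_layer (J := Empty) (β := Empty)
    (ι := Fin d × Fin (b + 1)) d (fun _ => or) (fun _ u _ => u) (fun j => (j, Fin.last b))
    (fun j => (j, ⟨b - 1, by omega⟩)) (fun j => (j, Fin.last b)) (c.rename .inr)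
  refine ⟨c', ?_, fun a => ⟨_, (hr' _ a).trans ((Circuit.run_rename _ _ _ _).trans (hr _ _)), ?_⟩⟩
  · rw [Circuit.size_rename] at hc'
    rw [List.length_finRange] at hc
    have : d * (2 * (min t (d + 1) + 1)) ≤ d * (2 * (d + 2)) :=
      Nat.mul_le_mul_left _ (by omega)
    unfold testSize
    omega
  · have h1 : ∀ x : Fin d → Bool,
        (List.finRange d).countP (fun j => decide (L j = some (x j))) = litCount L x := by
      intro x
      rw [litCount, List.countP_eq_length_filter, Finset.card_def, Finset.filter_val]
      rfl
    have h2 : litCount L (roundBits a) ≤ d := (Finset.card_le_univ _).trans_eq (by simp)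
    rw [decide_eq_true_iff]
    change min t (d + 1) ≤ (List.finRange d).countP (fun j => decide (L j = some (roundBits a j))) ↔
      t ≤ litCount L (roundBits a)
    rw [h1]
    omega

theorem IsTest.map_eq {d b : ℕ} {E : Set (Fin d → Bool)} {T : PlainCircuit (Fin d × Fin (b + 1)) Unit}
    (hT : ∀ a, ∃ r : Bool, T.eval a = PMF.pure (fun _ => r) ∧ (r = true ↔ roundBits a ∈ E))
    (μ : PMF (Fin d × Fin (b + 1) → Bool)) :
    prob (μ.bind T.eval) {t | t () = true} = prob (μ.map roundBits) E := by
  classical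
  rw [prob_bind, prob_map, prob_eq_sum]
  refine Finset.sum_congr rfl fun a _ => ?_
  obtain ⟨r, h1, h2⟩ := hT a
  rw [h1, prob, PMF.toOuterMeasure_pure_apply]
  congr 1
  by_cases h : roundBits a ∈ E
  · simp [h, h2.2 h]
  · have : r = false := by
      rw [← Bool.not_eq_true]; exact fun hr => h (h2.1 hr)
    simp [h, this]

/-- Each column with a clear majority prescribes one literal, and correctness means that the count
reaches the number of prescribed literals. -/
theorem isTest_roughlyCorrect {n d : ℕ} (b : ℕ) (X : Fin n → Fin d → Bool) :
    IsTest d b {x | RoughlyCorrect X x} := by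
  classical
  let L : Fin d → Option Bool := fun j =>
    if 3 / 5 ≤ bitAvg (fun i => X i j) then some true
    else if bitAvg (fun i => X i j) < 2 / 5 then some false else none
  have h : {x | RoughlyCorrect X x} =
      {x | (Finset.univ.filter fun j => L j ≠ none).card ≤ litCount L x} := by
    ext x
    simp only [Set.mem_ofPred_eq, litCount]
    have hsub : (Finset.univ.filter fun j => L j = some (x j)) ⊆
        Finset.univ.filter fun j => L j ≠ none := by
      intro j hj
      simp only [Finset.mem_filter, Finset.mem_univ, true_and] at hj ⊢
      rw [hj]; simp
    constructor
    · intro hx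
      refine Finset.card_le_card fun j hj => ?_
      simp only [Finset.mem_filter, Finset.mem_univ, true_and, L] at hj ⊢
      obtain ⟨h1, h2⟩ := hx j
      split_ifs with h3 h4
      · rw [h1 h3]
      · rw [h2 h4]
      · simp [h3, h4] at hj
    · intro hx j
      have heq := Finset.eq_of_subset_of_card_le hsub hx
      have hj : L j ≠ none → L j = some (x j) := fun hne => by
        have : j ∈ Finset.univ.filter fun j => L j ≠ none := by simp [hne]
        rw [← heq] at this
        simpa using this
      constructor
      · intro h1
        have : L j = some true := if_pos h1
        rw [this] at hj
        simpa using (hj (by simp)).symm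
      · intro h1
        have : L j = some false := by
          simp only [L]
          rw [if_neg (by linarith), if_pos h1]
        rw [this] at hj
        simpa using (hj (by simp)).symm
  rw [h]
  exact isTest_litCount b L _

/-- A column with score -1 contributes -b = (1 - b) - 1. Hence the score is a count of literals
minus the number `q` of such columns. -/
theorem isTest_lt_score {n d : ℕ} (b : ℕ) (code : Fin d → Column n) (i : Fin n) {T : ℝ}
    (hT : 0 ≤ T) : IsTest d b {x | T < score code i x} := by
  classical
  let pos : Fin d → Prop := fun j => (code j).1 = none ∧ (code j).2.1 i = true ∧ (code j).2.2 i = false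
  let neg : Fin d → Prop := fun j => (code j).1 = none ∧ (code j).2.1 i = false ∧ (code j).2.2 i = true
  let L : Fin d → Option Bool := fun j => if pos j then some true else if neg j then some false else none
  let q : ℕ := (Finset.univ.filter neg).card
  have hscore : ∀ x, score code i x = (litCount L x : ℝ) - q := by
    intro x
    simp only [litCount, q, Finset.card_filter, Nat.cast_sum]
    rw [← Finset.sum_sub_distrib, score]
    refine Finset.sum_congr rfl fun j _ => ?_
    by_cases hcj : (code j).1 = none
    · rcases Bool.eq_false_or_eq_true ((code j).2.1 i) with h1 | h1 <;>
      rcases Bool.eq_false_or_eq_true ((code j).2.2 i) with h2 | h2 <;>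
      rcases Bool.eq_false_or_eq_true (x j) with h3 | h3 <;>
        simp [L, pos, neg, hcj, h1, h2, h3, columnScore, bitVal]
    · simp [L, pos, neg, hcj, columnScore]
  have h : {x | T < score code i x} = {x | ⌊T⌋₊ + 1 + q ≤ litCount L x} := by
    ext x
    simp only [Set.mem_ofPred_eq, hscore]
    rw [lt_sub_iff_add_lt]
    constructor
    · intro h1
      have : ((⌊T⌋₊ + q : ℕ) : ℝ) < litCount L x := by
        push_cast
        linarith [Nat.floor_le hT]
      have : ⌊T⌋₊ + q < litCount L x := by exact_mod_cast this
      omega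
    · intro h1
      have : ((⌊T⌋₊ + 1 + q : ℕ) : ℝ) ≤ litCount L x := by exact_mod_cast h1
      push_cast at this
      linarith [Nat.lt_floor_add_one T]
  rw [h]
  exact isTest_litCount b L _

theorem indep_fin_one {α : Type} [Fintype α] (D : Fin 1 → PMF α) :
    indep D = (D 0).map fun y _ => y := by
  rw [indep_fin_succ]
  simp only [indep_fin_zero, PMF.pure_map]
  rw [PMF.map]
  congr 1
  funext y
  simp only [Function.comp_apply]
  congr 1
  funext i
  rw [Fin.fin_one_eq_zero i]
  rfl

section adversaries
variable {P : MILRScheme} {n d s : ℕ → ℕ} (A : DAAlgorithm P n d s) {l : ℕ}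

/-- The rounded answer of the second part of an algorithm. -/
def respond (z : Bits (s l)) (q : DAQuery P l (n l) (d l)) : PMF (Fin (d l) → Bool) :=
  ((A.A₂ l).eval (Sum.elim z q.toBits)).map roundBits

theorem run_comp_respond {J β : Type} [Fintype β] {T : PlainCircuit (Fin (d l) × Fin (A.prec l + 1)) Unit}
    {E : Set (Fin (d l) → Bool)}
    (hT : ∀ a, ∃ r : Bool, T.eval a = PMF.pure (fun _ => r) ∧ (r = true ↔ roundBits a ∈ E))
    (O : J → Bool → PMF (β → Bool)) (z : Bits (s l)) (q : DAQuery P l (n l) (d l)) :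
    prob ((Circuit.comp (A.A₂ l) (Circuit.comp T (.out id))).run O (Sum.elim z q.toBits))
      {a | a () = true} = prob (respond A z q) E := by
  rw [Circuit.run_comp, respond, ← IsTest.map_eq hT]
  congr 2
  funext a
  rw [Circuit.run_comp]
  exact PMF.bind_pure _

/-- A bound for the size of the adversaries. -/
def adversarySize (l : ℕ) : ℕ :=
  testSize (d l) + (A.A₂ l).size + n l * (d l * (2 + P.cipherLen l)) + d l * (2 + P.cipherLen l) + 3

theorem size_comp_respond_le {J β : Type} [Fintype β]
    {T : PlainCircuit (Fin (d l) × Fin (A.prec l + 1)) Unit} (hT : T.size ≤ testSize (d l)) :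
    (Circuit.comp (A.A₂ l) (Circuit.comp T (.out id : Circuit J β Unit Unit))).size ≤
      (A.A₂ l).size + testSize (d l) + 1 := by
  have h1 := Circuit.size_comp_le (A.A₂ l) (Circuit.comp T (.out id : Circuit J β Unit Unit))
  have h2 := Circuit.size_comp_le T (.out id : Circuit J β Unit Unit)
  simp only [Circuit.size, Fintype.card_unit] at h2
  omega

/-- An adversary that has a matrix of constant messages encrypted, and that tests the answers. -/
theorem exists_leakage_adversary {N : ℕ} (e : Fin (n l) → Fin N) (X : Fin (n l) → Fin (d l) → Bool)
    {E : Set (Fin (d l) → Bool)} (hE : IsTest (d l) (A.prec l) E) :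
    ∃ B : Circuit (Fin N) (Fin (P.cipherLen l)) Unit (Fin (s l) ⊕ Fin N × Fin (P.paramLen l)),
      B.size ≤ adversarySize A l ∧
      ∀ O (z : Bits (s l)) (p : Fin N → Bits (P.paramLen l)),
        prob (B.run O (Sum.elim z fun i => p i.1 i.2)) {a | a () = true} =
          prob ((indep fun i => indep fun j => O (e i) (X i j)).bind
            fun c => respond A z ⟨p ∘ e, c⟩) E := by
  obtain ⟨T, hT, hTe⟩ := hE
  let σ : Fin (s l) ⊕ DAQueryIdx P l (n l) (d l) →
      (Fin (s l) ⊕ Fin N × Fin (P.paramLen l)) ⊕ Fin (n l) × Fin (d l) × Fin (P.cipherLen l) :=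
    Sum.elim (fun k => .inl (.inl k)) (Sum.elim (fun w => .inl (.inr (e w.1, w.2))) .inr)
  obtain ⟨B, hB, hr⟩ := Circuit.exists_query_matrix (κ := Unit) e X
    ((Circuit.comp (A.A₂ l) (Circuit.comp T (.out id))).rename σ)
  refine ⟨B, ?_, fun O z p => ?_⟩
  · rw [Circuit.size_rename, Fintype.card_fin] at hB
    have := size_comp_respond_le A (J := Fin N) (β := Fin (P.cipherLen l)) hT
    unfold adversarySize
    omega
  · rw [hr, prob_bind, prob_bind]
    refine Finset.sum_congr rfl fun c _ => ?_
    congr 1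
    rw [Circuit.run_rename, ← run_comp_respond A hTe O z ⟨p ∘ e, c⟩]
    congr 2
    funext w
    rcases w with w | w | w <;> rfl

/-- An adversary that has messages of a single user encrypted, where everything that concerns the
other users is constant, and that tests the answers. -/
theorem exists_semantic_adversary (i : Fin (n l)) (z : Bits (s l)) (q : DAQuery P l (n l) (d l))
    (m : Fin (d l) → Bool) {E : Set (Fin (d l) → Bool)} (hE : IsTest (d l) (A.prec l) E) :
    ∃ B : Circuit (Fin 1) (Fin (P.cipherLen l)) Unit (Fin 1 × Fin (P.paramLen l)),
      B.size ≤ adversarySize A l ∧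
      ∀ O (p : Fin 1 → Bits (P.paramLen l)),
        prob (B.run O fun i => p i.1 i.2) {a | a () = true} =
          prob ((indep fun j => O 0 (m j)).bind fun y => respond A z
            ⟨Function.update q.param i (p 0), Function.update q.cipher i y⟩) E := by
  obtain ⟨T, hT, hTe⟩ := hE
  let g : Fin (s l) ⊕ DAQueryIdx P l (n l) (d l) →
      ((Fin 1 × Fin (P.paramLen l)) ⊕ Fin 1 × Fin (d l) × Fin (P.cipherLen l)) ⊕ Bool :=
    Sum.elim (fun k => .inr (z k)) (Sum.elim
      (fun w => if w.1 = i then .inl (.inl (0, w.2)) else .inr (q.param w.1 w.2))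
      (fun w => if w.1 = i then .inl (.inr (0, w.2)) else .inr (q.cipher w.1 w.2.1 w.2.2)))
  obtain ⟨B', hB', hr'⟩ := Circuit.exists_const g
    (Circuit.comp (J := Fin 1) (β := Fin (P.cipherLen l)) (A.A₂ l) (Circuit.comp T (.out id)))
  obtain ⟨B, hB, hr⟩ := Circuit.exists_query_matrix (κ := Unit) (id : Fin 1 → Fin 1) (fun _ => m) B'
  refine ⟨B, ?_, fun O p => ?_⟩
  · rw [Fintype.card_fin] at hB
    have := size_comp_respond_le A (J := Fin 1) (β := Fin (P.cipherLen l)) hT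
    unfold adversarySize
    omega
  · rw [hr, indep_fin_one, PMF.bind_map, prob_bind, prob_bind]
    refine Finset.sum_congr rfl fun c _ => ?_
    congr 1
    rw [Function.comp_apply, hr', ← run_comp_respond A hTe O z
      ⟨Function.update q.param i (p 0), Function.update q.cipher i c⟩]
    congr 2
    funext w
    rcases w with w | w | w
    · rfl
    · by_cases h : w.1 = i
      · simp [g, h, DAQuery.toBits]
      · simp [g, h, DAQuery.toBits]
    · by_cases h : w.1 = i
      · simp [g, h, DAQuery.toBits]
      · simp [g, h, DAQuery.toBits]

/-! ### The games -/

/-- Bitwise encryptions of a matrix of messages. -/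
def encMatrix (P : MILRScheme) {l n d : ℕ} (x : Fin n → Bits l) (p : Fin n → Bits (P.paramLen l))
    (X : Fin n → Fin d → Bool) : PMF (Fin n → Fin d → Bits (P.cipherLen l)) :=
  indep fun i => indep fun j => P.Enc l (x i) (p i) (X i j)

/-- The leakage of the first part of an algorithm on the keys that are selected by `e`. -/
def leak {N : ℕ} (e : Fin (n l) → Fin N) (x : Fin N → Bits l) : PMF (Bits (s l)) :=
  (A.A₁ l).eval fun i => x (e i.1) i.2

/-- The rounded answers in the leakage game. -/
def leakDist {N : ℕ} (b : Bool) (e : Fin (n l) → Fin N)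
    (J : (Fin N → Bits l) → Bits (s l) → (Fin N → Bits (P.paramLen l)) → PMF (Finset (Fin N)))
    (X : Fin (n l) → Fin (d l) → Bool) : PMF (Fin (d l) → Bool) :=
  (iid N (P.Gen l)).bind fun x => (leak A e x).bind fun z => (iid N (P.Param l)).bind fun p =>
    (J x z p).bind fun S => (indep fun i => indep fun j => P.oracle b x p S (e i) (X i j)).bind
      fun c => respond A z ⟨p ∘ e, c⟩

/-- The rounded answers on a dataset that is a function of the keys. -/
def answerDist {N : ℕ} (e : Fin (n l) → Fin N) (D : (Fin N → Bits l) → Fin (n l) → Bits l)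
    (X : Fin (n l) → Fin (d l) → Bool) : PMF (Fin (d l) → Bool) :=
  (iid N (P.Gen l)).bind fun x => (iid N (P.Param l)).bind fun p =>
    (encMatrix P (x ∘ e) (p ∘ e) X).bind fun c => (A.answer l (D x) ⟨p ∘ e, c⟩).map roundBits

theorem leakageGame_eq {N : ℕ} (b : Bool) (e : Fin (n l) → Fin N)
    (J : (Fin N → Bits l) → Bits (s l) → (Fin N → Bits (P.paramLen l)) → PMF (Finset (Fin N)))
    (X : Fin (n l) → Fin (d l) → Bool) {E : Set (Fin (d l) → Bool)}
    {B : Circuit (Fin N) (Fin (P.cipherLen l)) Unit (Fin (s l) ⊕ Fin N × Fin (P.paramLen l))}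
    (hB : ∀ O (z : Bits (s l)) (p : Fin N → Bits (P.paramLen l)),
        prob (B.run O (Sum.elim z fun i => p i.1 i.2)) {a | a () = true} =
          prob ((indep fun i => indep fun j => O (e i) (X i j)).bind
            fun c => respond A z ⟨p ∘ e, c⟩) E) :
    P.leakageGame b (leak A e) J B = prob (leakDist A b e J X) E := by
  rw [MILRScheme.leakageGame, leakDist, prob_bind, prob_bind]
  refine Finset.sum_congr rfl fun x _ => ?_
  rw [prob_bind, prob_bind]
  congr 1
  refine Finset.sum_congr rfl fun z _ => ?_
  rw [prob_bind, prob_bind]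
  congr 1
  refine Finset.sum_congr rfl fun p _ => ?_
  rw [prob_bind, prob_bind]
  congr 1
  exact Finset.sum_congr rfl fun S _ => by rw [hB]

theorem answer_map_roundBits (D : Fin (n l) → Bits l) (q : DAQuery P l (n l) (d l)) :
    (A.answer l D q).map roundBits =
      ((A.A₁ l).eval fun i => D i.1 i.2).bind fun z => respond A z q := by
  rw [DAAlgorithm.answer, PMF.map_bind]
  rfl

/-- The oracle ℰ₁ ignores the hidden set, so `J` averages out, and leakage followed by response is
just the algorithm itself. -/
theorem leakDist_true {N : ℕ} (e : Fin (n l) → Fin N)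
    (J : (Fin N → Bits l) → Bits (s l) → (Fin N → Bits (P.paramLen l)) → PMF (Finset (Fin N)))
    (X : Fin (n l) → Fin (d l) → Bool) :
    leakDist A true e J X = answerDist A e (fun x => x ∘ e) X := by
  rw [leakDist, answerDist]
  congr 1
  funext x
  have h : ∀ z p, ((J x z p).bind fun S =>
      (indep fun i => indep fun j => P.oracle true x p S (e i) (X i j)).bind
        fun c => respond A z ⟨p ∘ e, c⟩) =
      (encMatrix P (x ∘ e) (p ∘ e) X).bind fun c => respond A z ⟨p ∘ e, c⟩ := by
    intro z p
    exact PMF.bind_const (J x z p)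
      ((encMatrix P (x ∘ e) (p ∘ e) X).bind fun c => respond A z ⟨p ∘ e, c⟩)
  simp only [h]
  rw [PMF.bind_comm]
  congr 1
  funext p
  rw [PMF.bind_comm]
  congr 1
  funext c
  rw [answer_map_roundBits]
  rfl

/-- The answers are roughly correct with probability `9 / 10`. -/
theorem le_prob_roughlyCorrect (hA : A.Solves) {N : ℕ} (e : Fin (n l) → Fin N)
    (X : Fin (n l) → Fin (d l) → Bool) :
    9 / 10 ≤ prob (answerDist A e (fun x => x ∘ e) X) {b | RoughlyCorrect X b} := by
  refine le_prob_bind _ _ _ fun x hx => le_prob_bind _ _ _ fun p hp => le_prob_bind _ _ _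
    fun c hc => ?_
  have hx' : ∀ i, (x ∘ e) i ∈ (P.Gen l).support := fun i => mem_support_indep hx (e i)
  have hp' : ∀ i, (p ∘ e) i ∈ (P.Param l).support := fun i => mem_support_indep hp (e i)
  have hc' : ∀ i j, c i j ∈ (P.Enc l ((x ∘ e) i) ((p ∘ e) i) (X i j)).support := fun i j =>
    mem_support_indep (mem_support_indep hc i) j
  have hdav : ∀ j, DAQuery.dav (⟨p ∘ e, c⟩ : DAQuery P l (n l) (d l)) (x ∘ e) j =
      bitAvg fun i => X i j := by
    intro j
    simp only [DAQuery.dav, bitAvg, bitVal]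
    congr 1
    refine Finset.sum_congr rfl fun i _ => ?_
    rw [P.dec_enc l _ (hx' i) _ (hp' i) _ _ (hc' i j)]
  refine (hA l (x ∘ e) ⟨p ∘ e, c⟩ ⟨hp', X, hc'⟩).trans ?_
  rw [prob_map]
  refine prob_mono _ fun a ha => RoughlyCorrect.of_abs_le fun j => ?_
  rw [← hdav]
  exact ha j

/-- Replacing the key of a user by a constant one. -/
def withoutUser {N : ℕ} (e : Fin (n l) → Fin N) (i : Fin (n l)) (x : Fin N → Bits l) :
    Fin (n l) → Bits l := Function.update (x ∘ e) i fun _ => false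

/-- Privacy is applied for each fixed choice of keys, parameters and ciphertexts. The query still
contains ciphertexts under the removed key; this is permitted because privacy is required for all
queries, valid or not. -/
theorem prob_answerDist_le_of_cdp {N : ℕ} (e : Fin (n l) → Fin N) (X : Fin (n l) → Fin (d l) → Bool)
    (i : Fin (n l)) {E : Set (Fin (d l) → Bool)} (hE : IsTest (d l) (A.prec l) E) {a b : ℝ}
    (h : ∀ (q : DAQuery P l (n l) (d l)) (D : Bool → Fin (n l) → Bits l)
        (T : PlainCircuit (Fin (d l) × Fin (A.prec l + 1)) Unit),
        Neighboring (D false) (D true) → T.size ≤ testSize (d l) →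
        prob ((A.answer l (D false) q).bind T.eval) {t | t () = true} ≤
          a * prob ((A.answer l (D true) q).bind T.eval) {t | t () = true} + b) :
    prob (answerDist A e (fun x => x ∘ e) X) E ≤
      a * prob (answerDist A e (withoutUser e i) X) E + b := by
  obtain ⟨T, hT, hTe⟩ := hE
  refine prob_bind_le _ _ _ _ _ fun x _ => prob_bind_le _ _ _ _ _ fun p _ =>
    prob_bind_le _ _ _ _ _ fun c _ => ?_
  have := h ⟨p ∘ e, c⟩ (fun b => if b then withoutUser e i x else x ∘ e) T
    ⟨i, fun j hj => by simp [withoutUser, Function.update_of_ne hj]⟩ hT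
  rw [IsTest.map_eq hTe, IsTest.map_eq hTe] at this
  simpa using this

/-- The rounded answers if only the key, the parameter and the ciphertexts of one user are
random. -/
def singleDist (i : Fin (n l)) (z : Bits (s l)) (q : DAQuery P l (n l) (d l))
    (m : Fin (d l) → Bool) : PMF (Fin (d l) → Bool) :=
  (P.Gen l).bind fun k => (P.Param l).bind fun π => (indep fun j => P.Enc l k π (m j)).bind fun y =>
    respond A z ⟨Function.update q.param i π, Function.update q.cipher i y⟩

theorem iid_one {α : Type} [Fintype α] (μ : PMF α) : iid 1 μ = μ.map fun y _ => y :=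
  indep_fin_one _

/-- With one user and all coordinates hidden, ℰ₁ encrypts the messages and ℰ₀ encrypts zeros. -/
theorem prob_singleDist_le (i : Fin (n l)) (z : Bits (s l)) (q : DAQuery P l (n l) (d l))
    (m : Fin (d l) → Bool) {E : Set (Fin (d l) → Bool)} (hE : IsTest (d l) (A.prec l) E) {ν : ℝ}
    (h : ∀ B : Circuit (Fin 1) (Fin (P.cipherLen l)) Unit (Fin 1 × Fin (P.paramLen l)),
      B.size ≤ adversarySize A l → |P.semanticGame false B - P.semanticGame true B| ≤ ν) :
    prob (singleDist A i z q m) E ≤ 1 * prob (singleDist A i z q fun _ => false) E + ν := by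
  obtain ⟨B, hB, hr⟩ := exists_semantic_adversary A i z q m hE
  have hgame : ∀ (b : Bool) (m' : Fin (d l) → Bool)
      (_ : ∀ x p j, P.oracle b x p Finset.univ (0 : Fin 1) (m j) = P.Enc l (x 0) (p 0) (m' j)),
      P.semanticGame b B = prob (singleDist A i z q m') E := by
    intro b m' hm
    rw [MILRScheme.semanticGame, singleDist, iid_one, iid_one, PMF.bind_map, prob_bind, prob_bind]
    refine Finset.sum_congr rfl fun k _ => ?_
    rw [Function.comp_apply, PMF.bind_map, prob_bind, prob_bind]
    congr 1
    refine Finset.sum_congr rfl fun π _ => ?_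
    have := hr (P.oracle b (fun _ => k) (fun _ => π) Finset.univ) fun _ => π
    simp only [hm] at this
    rw [← this]
    rfl
  have h1 := hgame true m fun x p j => rfl
  have h0 := hgame false (fun _ => false) fun x p j => by
    simp [MILRScheme.oracle, MILRScheme.oracle₀]
  have := h B hB
  rw [h0, h1] at this
  linarith [(abs_le.1 this).1]

/-- The summary no longer involves the key of user `i`, so the key, parameter and ciphertexts of
this user can be sampled last. Injectivity of `e` ensures that this resampling affects no other
user. The row `i` of `X₀` is arbitrary, so two matrices that differ only there get the same outer
distribution. -/
theorem answerDist_withoutUser {N : ℕ} {e : Fin (n l) → Fin N} (he : Function.Injective e)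
    (i : Fin (n l)) (X X₀ : Fin (n l) → Fin (d l) → Bool) (hX : ∀ k, k ≠ i → X k = X₀ k) :
    answerDist A e (withoutUser e i) X =
      (iid N (P.Gen l)).bind fun x => (iid N (P.Param l)).bind fun p =>
        (encMatrix P (x ∘ e) (p ∘ e) X₀).bind fun c =>
          ((A.A₁ l).eval fun w => withoutUser e i x w.1 w.2).bind fun z =>
            singleDist A i z ⟨p ∘ e, c⟩ (X i) := by
  have hiid : ∀ {α β : Type} [Fintype α] (μ : PMF α) (f : (Fin N → α) → PMF β),
      (iid N μ).bind f = (iid N μ).bind fun x => μ.bind fun k => f (Function.update x (e i) k) := by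
    intro α β _ μ f
    have h : iid N μ = (iid N μ).bind fun x => μ.map (Function.update x (e i)) :=
      indep_eq_bind_update _ _ (e i) fun _ _ => rfl
    conv_lhs => rw [h]
    simp only [PMF.bind_bind, PMF.bind_map, Function.comp_def]
  have hupd : ∀ {α : Type} (x : Fin N → α) (k : α),
      Function.update x (e i) k ∘ e = Function.update (x ∘ e) i k := fun x k =>
    Function.update_comp_eq_of_injective x he i k
  have hwo : ∀ x k, withoutUser e i (Function.update x (e i) k) = withoutUser e i x := by
    intro x k
    rw [withoutUser, hupd, Function.update_idem, withoutUser]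
  have henc : ∀ (x : Fin N → Bits l) (p : Fin N → Bits (P.paramLen l)) k π,
      encMatrix P (Function.update (x ∘ e) i k) (Function.update (p ∘ e) i π) X =
      (encMatrix P (x ∘ e) (p ∘ e) X₀).bind fun c =>
        (indep fun j => P.Enc l k π (X i j)).map (Function.update c i) := by
    intro x p k π
    have := indep_eq_bind_update
      (fun r => indep fun j =>
        P.Enc l (Function.update (x ∘ e) i k r) (Function.update (p ∘ e) i π r) (X r j))
      (fun r => indep fun j => P.Enc l ((x ∘ e) r) ((p ∘ e) r) (X₀ r j)) i
      (fun r hr => by simp only [Function.update_of_ne hr, hX r hr])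
    rw [encMatrix, encMatrix, this]
    simp only [Function.update_self]
  rw [answerDist, hiid]
  congr 1
  funext x
  have h1 : ∀ k, ((iid N (P.Param l)).bind fun p =>
      (encMatrix P (Function.update x (e i) k ∘ e) (p ∘ e) X).bind fun c =>
        (A.answer l (withoutUser e i (Function.update x (e i) k)) ⟨p ∘ e, c⟩).map roundBits) =
      (iid N (P.Param l)).bind fun p => (encMatrix P (x ∘ e) (p ∘ e) X₀).bind fun c =>
        ((A.A₁ l).eval fun w => withoutUser e i x w.1 w.2).bind fun z =>
        (P.Param l).bind fun π => (indep fun j => P.Enc l k π (X i j)).bind fun y =>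
          respond A z ⟨Function.update (p ∘ e) i π, Function.update c i y⟩ := by
    intro k
    rw [hiid]
    congr 1
    funext p
    simp only [hupd, hwo, henc, answer_map_roundBits]
    simp only [PMF.bind_bind, PMF.bind_map]
    rw [PMF.bind_comm]
    congr 1
    funext c
    rw [PMF.bind_comm ((A.A₁ l).eval fun w => withoutUser e i x w.1 w.2)]
    congr 1
    funext π
    exact PMF.bind_comm _ _ _
  simp only [h1, singleDist]
  rw [PMF.bind_comm]
  congr 1
  funext p
  rw [PMF.bind_comm]
  congr 1
  funext c
  rw [PMF.bind_comm]

end adversaries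

/-! ### The attack: hidden ciphertexts, union bound and contradiction. -/

section attack
variable {P : MILRScheme} {n d s : ℕ → ℕ} (A : DAAlgorithm P n d s) {l : ℕ}

theorem prob_answerDist_withoutUser_le {N : ℕ} {e : Fin (n l) → Fin N}
    (he : Function.Injective e) (i : Fin (n l)) (X : Fin (n l) → Fin (d l) → Bool)
    {E : Set (Fin (d l) → Bool)} (hE : IsTest (d l) (A.prec l) E) {ν : ℝ}
    (h : ∀ B : Circuit (Fin 1) (Fin (P.cipherLen l)) Unit (Fin 1 × Fin (P.paramLen l)),
      B.size ≤ adversarySize A l → |P.semanticGame false B - P.semanticGame true B| ≤ ν) :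
    prob (answerDist A e (withoutUser e i) X) E ≤
      1 * prob (answerDist A e (withoutUser e i) (Function.update X i fun _ => false)) E + ν := by
  rw [answerDist_withoutUser A he i X (Function.update X i fun _ => false)
      fun k hk => (Function.update_of_ne hk _ _).symm,
    answerDist_withoutUser A he i (Function.update X i fun _ => false)
      (Function.update X i fun _ => false) fun _ _ => rfl]
  refine prob_bind_le _ _ _ _ _ fun x _ => prob_bind_le _ _ _ _ _ fun p _ =>
    prob_bind_le _ _ _ _ _ fun c _ => prob_bind_le _ _ _ _ _ fun z _ => ?_
  rw [Function.update_self]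
  exact prob_singleDist_le A i z _ (X i) hE h

theorem codeMean_prob_bind_le {k m : ℕ} {α β : Type} [Fintype α] (μ : PMF α)
    (f : (Fin m → Column k) → α → PMF β) (E : (Fin m → Column k) → Set β) {b : ℝ}
    (h : ∀ a ∈ μ.support, codeMean (fun code => prob (f code a) (E code)) ≤ b) :
    codeMean (fun code => prob (μ.bind (f code)) (E code)) ≤ b := by
  simp only [prob_bind, codeMean_sum, codeMean_const_mul]
  calc _ ≤ ∑ a, (μ a).toReal * b := by
        refine Finset.sum_le_sum fun a _ => ?_
        by_cases ha : a ∈ μ.support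
        · exact mul_le_mul_of_nonneg_left (h a ha) ENNReal.toReal_nonneg
        · simp [(PMF.apply_eq_zero_iff μ a).2 ha]
    _ = b := by rw [← Finset.sum_mul, sum_toReal, one_mul]

/-- The answers if the ciphertexts of the users in `S` carry no information. -/
def hiddenDist {N : ℕ} (e : Fin (n l) → Fin N) (x : Fin N → Bits l) (z : Bits (s l))
    (p : Fin N → Bits (P.paramLen l)) (S : Finset (Fin N)) (X : Fin (n l) → Fin (d l) → Bool) :
    PMF (Fin (d l) → Bool) :=
  (indep fun i => indep fun j => P.oracle false x p S (e i) (X i j)).bind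
    fun c => respond A z ⟨p ∘ e, c⟩

theorem hiddenDist_congr {N : ℕ} (e : Fin (n l) → Fin N) (x : Fin N → Bits l) (z : Bits (s l))
    (p : Fin N → Bits (P.paramLen l)) (S : Finset (Fin N)) (X X' : Fin (n l) → Fin (d l) → Bool)
    (h : ∀ i, e i ∉ S → X i = X' i) : hiddenDist A e x z p S X = hiddenDist A e x z p S X' := by
  have : (fun i => indep fun j => P.oracle false x p S (e i) (X i j)) =
      fun i => indep fun j => P.oracle false x p S (e i) (X' i j) := by
    funext i
    congr 1
    funext j
    by_cases hi : e i ∈ S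
    · simp [MILRScheme.oracle, MILRScheme.oracle₀, hi]
    · rw [h i hi]
  rw [hiddenDist, hiddenDist, this]

/-- Users outside the range of `e` may be exposed as well, but they only lower the count of relevant
ones. -/
theorem card_exposed_le {N m : ℕ} {e : Fin m → Fin N} (he : Function.Injective e)
    (S : Finset (Fin N)) {t : ℝ} (h : (N : ℝ) - t ≤ S.card) :
    ((Finset.univ.filter fun i => e i ∉ S).card : ℝ) ≤ t := by
  have h1 : (Finset.univ.filter fun i => e i ∉ S).card ≤ Sᶜ.card :=
    Finset.card_le_card_of_injOn e (fun i hi => by simpa using hi) he.injOn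
  have h2 : Sᶜ.card + S.card = N := by
    rw [Finset.card_compl_add_card, Fintype.card_fin]
  have h3 : ((Finset.univ.filter fun i => e i ∉ S).card : ℝ) ≤ (Sᶜ.card : ℝ) := by
    exact_mod_cast h1
  have h4 : (Sᶜ.card : ℝ) + S.card = N := by exact_mod_cast h2
  linarith

variable {N : ℕ} {e : Fin (n l) → Fin N} (he : Function.Injective e)
  {J : (Fin N → Bits l) → Bits (s l) → (Fin N → Bits (P.paramLen l)) → PMF (Finset (Fin N))}
  {t : ℝ} (hJ : ∀ x z p, ∀ S ∈ (J x z p).support, (N : ℝ) - t ≤ S.card)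

-- The keys, leakage, parameters and hidden set are sampled independently of the code. For each
-- fixed choice of them, the bound for answers that depend only on the exposed users applies.
include he hJ in
theorem codeMean_leakDist_no_accusation_le (hn : 0 < n l) (hd : 0 < d l) {T b : ℝ}
    (hT : ∀ m : ℕ, (m : ℝ) ≤ t → m * T < 3 / 4 / columnNorm * d l / 2 ∧
      16 * (m + 2) / ((3 / 4 / columnNorm) ^ 2 * d l) ≤ b) :
    codeMean (fun code => prob (leakDist A false e J (codeMessages code))
      {b | RoughlyCorrect (codeMessages code) b ∧ ∀ i : Fin (n l), score code i b ≤ T}) ≤ b := by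
  refine codeMean_prob_bind_le _ _ _ fun x _ => codeMean_prob_bind_le _ _ _ fun z _ =>
    codeMean_prob_bind_le _ _ _ fun p _ => codeMean_prob_bind_le _ _ _ fun S hS => ?_
  obtain ⟨h1, h2⟩ := hT _ (card_exposed_le he S (hJ x z p S hS))
  exact (codeMean_prob_no_accusation_le hn hd _ (hiddenDist A e x z p S)
    (fun X X' h => hiddenDist_congr A e x z p S X X' fun i hi => h i (by simpa using hi)) h1).trans
    h2

include he hJ in
theorem prob_leakDist_le_of_lt_one (ht : t < 1) (X X' : Fin (n l) → Fin (d l) → Bool)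
    (E : Set (Fin (d l) → Bool)) :
    prob (leakDist A false e J X) E ≤ 1 * prob (leakDist A false e J X') E + 0 := by
  refine prob_bind_le _ _ _ _ _ fun x _ => prob_bind_le _ _ _ _ _ fun z _ =>
    prob_bind_le _ _ _ _ _ fun p _ => prob_bind_le _ _ _ _ _ fun S hS => ?_
  have h1 := card_exposed_le he S (hJ x z p S hS)
  have h2 : (Finset.univ.filter fun i => e i ∉ S).card = 0 := by
    have : ((Finset.univ.filter fun i => e i ∉ S).card : ℝ) < 1 := h1.trans_lt ht
    exact Nat.lt_one_iff.1 (by exact_mod_cast this)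
  have h3 := hiddenDist_congr A e x z p S X X' fun i hi => by
    rw [Finset.card_eq_zero, Finset.filter_eq_empty_iff] at h2
    exact absurd hi (h2 (Finset.mem_univ i))
  rw [hiddenDist, hiddenDist] at h3
  rw [h3, one_mul, add_zero]

theorem prob_add_prob_le_one {α : Type} [Fintype α] (μ : PMF α) {E E' : Set α}
    (h : Disjoint E E') : prob μ E + prob μ E' ≤ 1 := by
  classical
  rw [prob_eq_sum, prob_eq_sum, ← Finset.sum_add_distrib]
  refine (Finset.sum_le_sum (g := fun a => (μ a).toReal) fun a _ => ?_).trans_eq (sum_toReal μ)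
  rw [← mul_add]
  refine mul_le_of_le_one_right ENNReal.toReal_nonneg ?_
  by_cases h1 : a ∈ E
  · have h2 : a ∉ E' := Set.disjoint_left.1 h h1
    simp [h1, h2]
  · by_cases h2 : a ∈ E' <;> simp [h1, h2]

theorem prob_le_prob_add_sum {α : Type} [Fintype α] (μ : PMF α) {ι : Type} [Fintype ι]
    (E E' : Set α) (G : ι → Set α) (h : ∀ a ∈ E, a ∈ E' ∨ ∃ i, a ∈ G i) :
    prob μ E ≤ prob μ E' + ∑ i, prob μ (G i) := by
  classical
  simp only [prob_eq_sum]
  rw [Finset.sum_comm, ← Finset.sum_add_distrib]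
  refine Finset.sum_le_sum fun a _ => ?_
  rw [← Finset.mul_sum, ← mul_add]
  refine mul_le_mul_of_nonneg_left ?_ ENNReal.toReal_nonneg
  have h0 : ∀ i, (0 : ℝ) ≤ if a ∈ G i then 1 else 0 := fun i => by split_ifs <;> norm_num
  have h0' : (0 : ℝ) ≤ if a ∈ E' then 1 else 0 := by split_ifs <;> norm_num
  have hs := Finset.sum_nonneg fun i (_ : i ∈ Finset.univ) => h0 i
  split_ifs with hE hE' hE'
  · linarith
  · obtain ⟨i, hi⟩ := (h a hE).resolve_left hE'
    have := Finset.single_le_sum (fun i _ => h0 i) (Finset.mem_univ i)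
    rw [if_pos hi] at this
    linarith
  · linarith
  · linarith

section bounds
variable {ν₁ : ℝ} (hleak : ∀ B : Circuit (Fin N) (Fin (P.cipherLen l)) Unit
    (Fin (s l) ⊕ Fin N × Fin (P.paramLen l)), B.size ≤ adversarySize A l →
      |P.leakageGame false (leak A e) J B - P.leakageGame true (leak A e) J B| ≤ ν₁)

-- Hiding the unexposed users is invisible to efficient tests, so estimates on actual answers
-- transfer to the hidden game and back.
include hleak in
theorem abs_prob_leakDist_sub_le (X : Fin (n l) → Fin (d l) → Bool) {E : Set (Fin (d l) → Bool)}
    (hE : IsTest (d l) (A.prec l) E) :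
    |prob (leakDist A false e J X) E - prob (answerDist A e (fun x => x ∘ e) X) E| ≤ ν₁ := by
  obtain ⟨B, hB, hr⟩ := exists_leakage_adversary A e X hE
  have := hleak B hB
  rwa [leakageGame_eq A false e J X hr, leakageGame_eq A true e J X hr, leakDist_true] at this

include hleak in
theorem le_prob_leakDist_roughlyCorrect (hA : A.Solves) (X : Fin (n l) → Fin (d l) → Bool) :
    9 / 10 - ν₁ ≤ prob (leakDist A false e J X) {b | RoughlyCorrect X b} := by
  have h1 := le_prob_roughlyCorrect A hA e X
  have h2 := abs_le.1 (abs_prob_leakDist_sub_le A hleak X (isTest_roughlyCorrect (A.prec l) X))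
  linarith [h2.1]

include he hJ hleak in
/-- If no user is exposed, then the answers cannot be correct. -/
theorem le_of_no_exposed_user (hA : A.Solves) (hn : 0 < n l) (hd : 0 < d l) (ht : t < 1) :
    2 / 5 ≤ ν₁ := by
  have hn0 : (n l : ℝ) ≠ 0 := by exact_mod_cast hn.ne'
  have h0 := le_prob_leakDist_roughlyCorrect A hleak hA fun _ _ => false
  have h1 := le_prob_leakDist_roughlyCorrect A hleak hA fun _ _ => true
  -- With nobody exposed, all-zero and all-one messages yield the same answers, but no answer is
  -- correct for both: 2(9/10 - ν₁) ≤ 1.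
  have h2 := prob_leakDist_le_of_lt_one A he hJ ht (fun _ _ => true) (fun _ _ => false)
    {b | RoughlyCorrect (fun (_ : Fin (n l)) _ => true) b}
  have h3 := prob_add_prob_le_one (leakDist A false e J fun _ _ => false)
    (E := {b | RoughlyCorrect (fun (_ : Fin (n l)) _ => false) b})
    (E' := {b | RoughlyCorrect (fun (_ : Fin (n l)) _ => true) b}) (by
      refine Set.disjoint_left.2 fun b hb hb' => ?_
      have h4 := (hb ⟨0, hd⟩).2 (by simp [bitAvg, bitVal])
      have h5 := (hb' ⟨0, hd⟩).1 (by simp [bitAvg, bitVal, hn0]; norm_num)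
      rw [h4] at h5
      exact absurd h5 (by simp))
  linarith

include he hJ hleak in
/-- The attack on the privacy of the algorithm. -/
theorem le_of_few_exposed_users (hA : A.Solves) (hn : 0 < n l) (hd : 0 < d l) {a δ ν₂ ν₃ T : ℝ}
    (ha : 0 ≤ a)
    (hcdp : ∀ (q : DAQuery P l (n l) (d l)) (D : Bool → Fin (n l) → Bits l)
        (T : PlainCircuit (Fin (d l) × Fin (A.prec l + 1)) Unit),
        Neighboring (D false) (D true) → T.size ≤ testSize (d l) →
        prob ((A.answer l (D false) q).bind T.eval) {t | t () = true} ≤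
          a * prob ((A.answer l (D true) q).bind T.eval) {t | t () = true} + (δ + ν₂))
    (hsem : ∀ B : Circuit (Fin 1) (Fin (P.cipherLen l)) Unit (Fin 1 × Fin (P.paramLen l)),
      B.size ≤ adversarySize A l → |P.semanticGame false B - P.semanticGame true B| ≤ ν₃)
    (hT₀ : 0 ≤ T)
    (hT : ∀ m : ℕ, (m : ℝ) ≤ t → m * T < 3 / 4 / columnNorm * d l / 2 ∧
      16 * (m + 2) / ((3 / 4 / columnNorm) ^ 2 * d l) ≤ 1 / 10) :
    9 / 10 - ν₁ ≤
      1 / 10 + n l * (a * (Real.exp (-(T ^ 2 / (2 * d l))) + ν₃) + (δ + ν₂) + ν₁) := by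
  let K : Fin (n l) → (Fin (n l) → Fin (d l) → Bool) → PMF (Fin (d l) → Bool) := fun i X =>
    answerDist A e (withoutUser e i) (Function.update X i fun _ => false)
  -- Three hybrids: reveal the hidden ciphertexts, remove the key of user i, erase the messages of
  -- user i.
  have huser : ∀ (code : Fin (d l) → Column (n l)) (i : Fin (n l)),
      prob (leakDist A false e J (codeMessages code)) {b | T < score code i b} ≤
        a * prob (K i (codeMessages code)) {b | T < score code i b} + (a * ν₃ + (δ + ν₂) + ν₁) := by
    intro code i
    have hE := isTest_lt_score (A.prec l) code i hT₀
    have h1 := abs_le.1 (abs_prob_leakDist_sub_le A hleak (codeMessages code) hE)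
    have h2 := prob_answerDist_le_of_cdp A e (codeMessages code) i hE hcdp
    have h3 := prob_answerDist_withoutUser_le A he i (codeMessages code) hE hsem
    have h4 := mul_le_mul_of_nonneg_left h3 ha
    simp only [K]
    linarith [h1.2]
  -- A roughly correct answer either accuses nobody or accuses some user; the latter is bounded by a
  -- union bound.
  have hcode : ∀ code : Fin (d l) → Column (n l), 9 / 10 - ν₁ ≤
      prob (leakDist A false e J (codeMessages code))
        {b | RoughlyCorrect (codeMessages code) b ∧ ∀ i : Fin (n l), score code i b ≤ T} +
      ∑ i, (a * prob (K i (codeMessages code)) {b | T < score code i b} +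
        (a * ν₃ + (δ + ν₂) + ν₁)) := by
    intro code
    refine (le_prob_leakDist_roughlyCorrect A hleak hA (codeMessages code)).trans ?_
    refine (prob_le_prob_add_sum _ _ _ (fun i => {b | T < score code i b}) fun b hb => ?_).trans
      (add_le_add le_rfl (Finset.sum_le_sum fun i _ => huser code i))
    by_cases h : ∀ i : Fin (n l), score code i b ≤ T
    · exact .inl ⟨hb, h⟩
    · push Not at h
      exact .inr h
  have hmean := codeMean_mono hcode
  rw [codeMean_const, codeMean_add, codeMean_sum Finset.univ fun i code =>
    a * prob (K i (codeMessages code)) {b | T < score code i b} +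
        (a * ν₃ + (δ + ν₂) + ν₁)] at hmean
  refine hmean.trans (add_le_add (codeMean_leakDist_no_accusation_le A he hJ hn hd hT) ?_)
  calc _ ≤ ∑ _i : Fin (n l),
        (a * Real.exp (-(T ^ 2 / (2 * d l))) + (a * ν₃ + (δ + ν₂) + ν₁)) := by
        refine Finset.sum_le_sum fun i _ => ?_
        rw [codeMean_add, codeMean_const_mul, codeMean_const]
        have := codeMean_prob_score_le hd i (K i) (fun X X' h => by
          simp only [K]
          congr 1
          funext k
          by_cases hk : k = i
          · subst hk; simp
          · simp only [Function.update_of_ne hk, h k hk]) T hT₀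
        linarith [mul_le_mul_of_nonneg_left this ha]
    _ = _ := by
        rw [Finset.sum_const, Finset.card_univ, Fintype.card_fin, nsmul_eq_mul]
        ring

end bounds

end attack

/-! ### The lower bound -/

/-- If few users are exposed, then the parameters of the attack can be chosen suitably. -/
theorem exists_attack_constant (ε : ℝ) : ∃ c : ℝ, 0 < c ∧ ∀ (n d : ℕ) (t : ℝ), 2 ≤ n → 0 < d →
    t < c * Real.sqrt (d / Real.log n) → 1 ≤ t →
    ∃ T : ℝ, 0 ≤ T ∧ n * (Real.exp ε * Real.exp (-(T ^ 2 / (2 * d)))) ≤ 1 / 8 ∧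
      ∀ m : ℕ, (m : ℝ) ≤ t → m * T < 3 / 4 / columnNorm * d / 2 ∧
        16 * (m + 2) / ((3 / 4 / columnNorm) ^ 2 * d) ≤ 1 / 10 := by
  set a : ℝ := 3 / 4 / columnNorm with ha
  have ha0 : 0 < a := div_pos (by norm_num) columnNorm_pos
  have hlog2 : 0 < Real.log 2 := Real.log_pos (by norm_num)
  -- With T² = 2d(log n + K), the union bound contributes e^(ε-K) ≤ e^(-3) ≤ 1/8.
  set K : ℝ := |ε| + 3 with hK
  have hK0 : 0 < K := by positivity
  -- As log n ≥ log 2, the constant K is absorbed: T² ≤ L d log n.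
  set L : ℝ := 2 * (1 + K / Real.log 2) with hL
  have hL0 : 0 < L := by positivity
  -- The second entry gives mT ≤ ad/4. The third bounds the Chebyshev error: for 1 ≤ t one has m + 2
  -- ≤ 3t², and 480 = 16 · 10 · 3. The first allows c² ≤ c.
  set c : ℝ := min 1 (min (a / (4 * Real.sqrt L)) (a ^ 2 * Real.log 2 / 480)) with hc
  have hc0 : 0 < c := lt_min one_pos (lt_min (by positivity) (by positivity))
  have hc1 : c ≤ 1 := min_le_left _ _
  have hc2 : c ≤ a / (4 * Real.sqrt L) := (min_le_right _ _).trans (min_le_left _ _)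
  have hc3 : c ≤ a ^ 2 * Real.log 2 / 480 := (min_le_right _ _).trans (min_le_right _ _)
  refine ⟨c, hc0, fun n d t hn hd ht ht₁ => ?_⟩
  have hd0 : (0 : ℝ) < d := by exact_mod_cast hd
  have hn2 : (2 : ℝ) ≤ n := by exact_mod_cast hn
  have hn0 : (0 : ℝ) < n := by linarith
  have hlog : Real.log 2 ≤ Real.log n := Real.log_le_log (by norm_num) hn2
  have hlogn : 0 < Real.log n := hlog2.trans_le hlog
  refine ⟨Real.sqrt (2 * d * (Real.log n + K)), Real.sqrt_nonneg _, ?_, fun m hm => ⟨?_, ?_⟩⟩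
  · have h1 : 2 * d * (Real.log n + K) / (2 * d) = Real.log n + K := by field_simp
    have h2 : (n : ℝ) * (Real.exp ε * Real.exp (-(Real.log n + K))) = Real.exp (ε - K) := by
      conv_lhs => rw [← Real.exp_log hn0, Real.log_exp]
      rw [← Real.exp_add, ← Real.exp_add]
      congr 1
      ring
    rw [Real.sq_sqrt (by positivity), h1, h2]
    have h3 : Real.exp (ε - K) ≤ Real.exp (-3) :=
      Real.exp_le_exp.2 (by rw [hK]; linarith [le_abs_self ε])
    have h4 : Real.exp (-3) = (Real.exp 1 ^ 3)⁻¹ := by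
      rw [Real.exp_neg, ← Real.exp_nat_mul]; norm_num
    have h5 : (2 : ℝ) ^ 3 ≤ Real.exp 1 ^ 3 :=
      pow_le_pow_left₀ (by norm_num) (by linarith [Real.add_one_le_exp 1]) 3
    have h6 : (Real.exp 1 ^ 3)⁻¹ ≤ ((2 : ℝ) ^ 3)⁻¹ := inv_anti₀ (by norm_num) h5
    rw [h4] at h3
    have h7 : ((2 : ℝ) ^ 3)⁻¹ = 1 / 8 := by norm_num
    linarith
  · have h1 : Real.sqrt (2 * d * (Real.log n + K)) ≤ Real.sqrt (L * d * Real.log n) := by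
      refine Real.sqrt_le_sqrt ?_
      have : K ≤ K / Real.log 2 * Real.log n := by
        rw [div_mul_eq_mul_div, le_div_iff₀ hlog2]
        exact mul_le_mul_of_nonneg_left hlog hK0.le
      calc 2 * d * (Real.log n + K) ≤ 2 * d * (Real.log n + K / Real.log 2 * Real.log n) := by
            gcongr
        _ = L * d * Real.log n := by rw [hL]; ring
    have h2 : Real.sqrt (d / Real.log n) * Real.sqrt (L * d * Real.log n) = Real.sqrt L * d := by
      rw [← Real.sqrt_mul (by positivity)]
      have : d / Real.log n * (L * d * Real.log n) = L * d ^ 2 := by field_simp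
      rw [this, Real.sqrt_mul hL0.le, Real.sqrt_sq hd0.le]
    calc (m : ℝ) * Real.sqrt (2 * d * (Real.log n + K))
        ≤ c * Real.sqrt (d / Real.log n) * Real.sqrt (L * d * Real.log n) := by
          refine mul_le_mul (hm.trans ht.le) h1 (Real.sqrt_nonneg _) (by positivity)
      _ = c * (Real.sqrt L * d) := by rw [mul_assoc, h2]
      _ ≤ a / (4 * Real.sqrt L) * (Real.sqrt L * d) := by gcongr
      _ = a * d / 4 := by
          have : Real.sqrt L ≠ 0 := (Real.sqrt_pos.2 hL0).ne'
          field_simp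
      _ < a * d / 2 := by
          have : 0 < a * d := by positivity
          linarith
  · rw [div_le_div_iff₀ (by positivity) (by norm_num), one_mul]
    have h1 : t ^ 2 ≤ (c * Real.sqrt (d / Real.log n)) ^ 2 :=
      pow_le_pow_left₀ (by linarith) ht.le 2
    rw [mul_pow, Real.sq_sqrt (by positivity)] at h1
    have h2 : c ^ 2 * (d / Real.log n) ≤ a ^ 2 * Real.log 2 / 480 * (d / Real.log 2) := by
      have : c ^ 2 ≤ c := by nlinarith
      gcongr
      exact this.trans hc3
    have h3 : a ^ 2 * Real.log 2 / 480 * (d / Real.log 2) = a ^ 2 * d / 480 := by field_simp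
    have h4 : (m : ℝ) + 2 ≤ 3 * t ^ 2 := by nlinarith
    linarith

/-- Outputs are charged for their length, so a polynomial running time bounds the space of the
summary. -/
theorem Circuit.card_le_size {J β κ ι : Type} [Fintype β] [Fintype κ] (c : Circuit J β κ ι) :
    Fintype.card κ ≤ c.size := by
  induction c with
  | out o => exact le_rfl
  | const b c ih => simp only [Circuit.size]; omega
  | gate f a b c ih => simp only [Circuit.size]; omega
  | coin c ih => simp only [Circuit.size]; omega
  | query j m c ih => simp only [Circuit.size]; omega

theorem polyBounded_testSize {g : ℕ → ℝ} (hg : AtLeastLinear g) {d : ℕ → ℕ}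
    (hd : PolyBounded g d) : PolyBounded g fun l => testSize (d l) :=
  ((polyBounded_const 2).mul hd).add hg ((polyBounded_const 3).add hg
    (hd.mul ((polyBounded_const 2).mul (hd.add hg (polyBounded_const 2)))))

theorem polyBounded_adversarySize {P : MILRScheme} {n d s : ℕ → ℕ} (A : DAAlgorithm P n d s)
    {g : ℕ → ℝ} (hg : AtLeastLinear g) (hn : PolyBounded g n) (hd : PolyBounded g d)
    (hA : A.PolyTime g) : PolyBounded g fun l => adversarySize A l := by
  have hc : PolyBounded g fun l => d l * (2 + P.cipherLen l) :=
    hd.mul ((polyBounded_const 2).add hg (P.cipherLen_poly.of_linear hg))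
  exact ((((polyBounded_testSize hg hd).add hg hA.2).add hg (hn.mul hc)).add hg hc).add hg
    (polyBounded_const 3)

theorem mainTheorem4 (ε : ℝ) :
    ∃ c : ℝ, 0 < c ∧
      ∀ (P : MILRScheme) (Γ : ℝ → ℝ) (τ : ℝ → ℝ → ℝ),
        (∃ c₀ : ℝ, 0 < c₀ ∧ ∀ᶠ l : ℕ in Filter.atTop, c₀ * (l : ℝ) ≤ Γ l) →
        P.Secure Γ τ →
      ∀ n d s : ℕ → ℕ,
        (∀ l, 2 ≤ n l) →
        PolyBounded (fun l => Γ l) n →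
        PolyBounded (fun l => Γ l) d →
      ∀ δ : ℕ → ℝ,
        (∀ l, δ (n l) ≤ 1 / (4 * (n l : ℝ) * (Real.exp ε + 1))) →
      ∀ A : DAAlgorithm P n d s,
        A.PolyTime (fun l => Γ l) →
        A.Solves →
        A.IsCDP Γ ε δ →
        ∀ᶠ l : ℕ in Filter.atTop,
          c * Real.sqrt ((d l : ℝ) / Real.log (n l)) ≤ τ l (s l) := by
  obtain ⟨c, hc, hatt⟩ := exists_attack_constant ε
  refine ⟨c, hc, fun P Γ τ hΓ hsec n d s hn₂ hn hd δ hδ A hA hsol hcdp => ?_⟩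
  replace hΓ : AtLeastLinear fun l : ℕ => Γ l := hΓ
  have hn₀ : ∀ l, 0 < n l := fun l => lt_of_lt_of_le (by norm_num) (hn₂ l)
  have hs : PolyBounded (fun l => Γ l) s := hA.1.mono fun l => by
    simpa using (A.A₁ l).card_le_size
  have hadv := polyBounded_adversarySize A hΓ hn hd hA
  have hadv₂ : ∀ l, 2 ≤ adversarySize A l := fun l => by unfold adversarySize; omega
  -- The space may exceed n·l, where leakage security says nothing. Adding s dummy users outside the
  -- dataset makes s admissible, and τ is unaffected because it depends only on l and s.
  obtain ⟨ν₁, hν₁, hleak⟩ := hsec.2.uniform (hn.add hΓ hs)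
    (fun l hl => (Nat.le_add_left (s l) (n l)).trans (Nat.le_mul_of_pos_right _
      (Nat.pos_of_ne_zero hl))) (fun l => leak A (Fin.castAdd (s l))) hadv hadv₂
  obtain ⟨ν₂, hν₂, hpriv⟩ := hcdp.uniform hΓ hn₀ hn hd hδ (fun l => by positivity)
    (polyBounded_testSize hΓ hd) (fun l => by unfold testSize; omega)
  obtain ⟨ν₃, hν₃, hsem⟩ := hsec.1.uniform hadv hadv₂
  have hlim : Tendsto (fun l => (n l : ℝ) * (Real.exp ε * ν₃ l + ν₂ l + ν₁ l)) atTop (nhds 0) :=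
    hn.tendsto_mul_zero (((hν₃.const_mul _).add hν₂).add hν₁)
  have hlim₁ : Tendsto ν₁ atTop (nhds 0) := by simpa using hν₁ 0
  filter_upwards [eventually_ne_atTop 0, hlim.eventually_lt_const (by norm_num : (0 : ℝ) < 1 / 5),
    hlim₁.eventually_lt_const (by norm_num : (0 : ℝ) < 1 / 5)] with l hl hη hη₁
  obtain ⟨J, hJ, hB⟩ := hleak l hl
  have he : Function.Injective (Fin.castAdd (s l) : Fin (n l) → Fin (n l + s l)) :=
    Fin.castAdd_injective _ _
  -- A hidden set cannot exceed the number of users. This settles d = 0, where the claimed bound is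
  -- zero.
  have ht₀ : 0 ≤ τ l (s l) := by
    obtain ⟨S, hS⟩ := (J (fun _ _ => false) (fun _ => false) fun _ _ => false).support_nonempty
    have h1 := hJ _ _ _ S hS
    have h2 : (S.card : ℝ) ≤ (n l + s l : ℕ) := by
      exact_mod_cast (Finset.card_le_univ S).trans_eq (Fintype.card_fin _)
    linarith
  by_contra! hlt
  have hd₀ : 0 < d l := by
    refine Nat.pos_of_ne_zero fun h0 => ?_
    rw [h0] at hlt
    simp at hlt
    linarith
  -- The second case needs τ ≥ 1 in order that τ < c√(d/log n) forces d to be large enough for the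
  -- Chebyshev bound.
  by_cases ht₁ : τ l (s l) < 1
  · linarith [le_of_no_exposed_user A he hJ hB hsol (hn₀ l) hd₀ ht₁]
  · obtain ⟨T, hT₀, hTε, hT⟩ := hatt (n l) (d l) _ (hn₂ l) hd₀ hlt (not_lt.1 ht₁)
    have key := le_of_few_exposed_users A he hJ hB hsol (hn₀ l) hd₀ (Real.exp_pos ε).le
      (fun q D T hD hT => (hpriv l q D T hD hT).trans_eq (add_assoc _ _ _)) (hsem l) hT₀ hT
    have hnl : (0 : ℝ) < n l := by exact_mod_cast hn₀ l
    have hδ₄ : (n l : ℝ) * (1 / (4 * (n l : ℝ) * (Real.exp ε + 1))) ≤ 1 / 4 := by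
      have h1 := Real.exp_pos ε
      have h2 : (n l : ℝ) * (1 / (4 * (n l : ℝ) * (Real.exp ε + 1))) =
          1 / (4 * (Real.exp ε + 1)) := by field_simp
      rw [h2]
      exact one_div_le_one_div_of_le (by norm_num) (by linarith)
    -- The attack yields 9/10 - ν₁ ≤ 1/10 + 1/8 + 1/4 + 1/5 = 27/40, whereas ν₁ < 1/5 makes the left
    -- side exceed 7/10.
    linarith

end
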